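/- Let $G$ be a second countable, locally compact (Hausdorff), unimodular group with Haar measure $\mu$, and let $(K_n)_{n\in\mathbb N}$ be a (right) strong Følner sequence in $G$, i.e. a sequence of nonnull compact sets with $\mu(K_nL\cap K_n^cL)/\mu(K_n)\to 0$ for every compact $L\subseteq G$ (such a sequence exists exactly when the unimodular group $G$ is amenable). Let $\pi$ be a projective discrete series representation of $G$ on a separable complex Hilbert space $\mathcal H$: a strongly measurable map $\pi:G\to\mathcal U(\mathcal H)$ with $\pi(x)\pi(y)=\sigma(x,y)\pi(xy)$ for some $\sigma:G\times G\to\mathbb T$, which is irreducible (no closed invariant subspaces other than $\{0\}$ and $\mathcal H$) and satisfies $\int_G|\langle h,\pi(x)h\rangle|^2\,d\mu(x)<\infty$ for some $h\neq0$. Then there is a unique $d_\pi>0$ (the formal degree of $\pi$) such that for all $f_1,f_2,g_1,g_2\in\mathcal H$ $$\int_G\langle f_1,\pi(x)g_1\rangle\langle\pi(x)g_2,f_2\rangle\,d\mu(x)=d_\pi^{-1}\langle f_1,f_2\rangle\overline{\langle g_1,g_2\rangle}$$ with absolutely convergent integral. Let $\Lambda\subseteq G$, and let $g\in\mathcal D_\pi$,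 i.e. $g\in\mathcal H$ and $\int_G\sup_{z\in Q}|\langle g,\pi(xz)g\rangle|^2\,d\mu(x)<\infty$ for some relatively compact symmetric neighborhood $Q$ of the identity. Consider the family $\pi(\Lambda)g=(\pi(\lambda)g)_{\lambda\in\Lambda}$. (i) If $\pi(\Lambda)g$ is a frame for $\mathcal H$, i.e. there are $A,B>0$ with $A\|f\|^2\le\sum_{\lambda\in\Lambda}|\langle f,\pi(\lambda)g\rangle|^2\le B\|f\|^2$ for all $f\in\mathcal H$, then the lower Beurling density $$D^-(\Lambda)=\lim_{n\to\infty}\inf_{x\in G}\frac{\#(\Lambda\cap xK_n)}{\mu(K_n)}$$ exists and $D^-(\Lambda)\ge d_\pi$. (ii) If $\pi(\Lambda)g$ is a Riesz sequence in $\mathcal H$, i.e. there are $A,B>0$ such that for all $c\in\ell^2(\Lambda)$ the series $\sum_{\lambda\in\Lambda}c_\lambda\pi(\lambda)g$ converges unconditionally and $A\|c\|^2\le\|\sum_{\lambda\in\Lambda}c_\lambda\pi(\lambda)g\|^2\le B\|c\|^2$, then the upper Beurling density $$D^+(\Lambda)=\lim_{n\to\infty}\sup_{x\in G}\frac{\#(\Lambda\cap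 xK_n)}{\mu(K_n)}$$ exists and $D^+(\Lambda)\le d_\pi$. -/

import Mathlib

open MeasureTheory Filter Topology
open scoped ENNReal Pointwise

namespace Coherent

/-- A strong Folner sequence with respect to the Haar measure `μ`: nonnull compact sets `K n` with
`μ (K n * L ∩ (K n)ᶜ * L) / μ (K n) → 0` for every compact set `L`. -/
structure IsStrongFolner {G : Type*} [Group G] [TopologicalSpace G] [MeasurableSpace G]
    (μ : Measure G) (K : ℕ → Set G) : Prop where
  isCompact : ∀ n, IsCompact (K n)
  nonnull : ∀ n, μ (K n) ≠ 0
  tendsto : ∀ L : Set G, IsCompact L →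
    Tendsto (fun n => μ ((K n * L) ∩ ((K n)ᶜ * L)) / μ (K n)) atTop (𝓝 0)

/-- `D` is the lower Beurling density of `Λ` along the sequence `K`: the limit
`lim_n inf_x #(Λ ∩ x K_n) / μ (K_n)` exists and equals `D`. -/
def HasLowerBeurlingDensity {G : Type*} [Group G] [MeasurableSpace G]
    (μ : Measure G) (K : ℕ → Set G) (Λ : Set G) (D : ℝ≥0∞) : Prop :=
  Tendsto (fun n => ⨅ x : G, ((Λ ∩ x • K n).encard : ℝ≥0∞) / μ (K n)) atTop (𝓝 D)

/-- `D` is the upper Beurling density of `Λ` along the sequence `K`: the limit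
`lim_n sup_x #(Λ ∩ x K_n) / μ (K_n)` exists and equals `D`. -/
def HasUpperBeurlingDensity {G : Type*} [Group G] [MeasurableSpace G]
    (μ : Measure G) (K : ℕ → Set G) (Λ : Set G) (D : ℝ≥0∞) : Prop :=
  Tendsto (fun n => ⨆ x : G, ((Λ ∩ x • K n).encard : ℝ≥0∞) / μ (K n)) atTop (𝓝 D)

/-- The family `e` is a frame for `H`. -/
def IsFrame {H ι : Type*} [NormedAddCommGroup H] [InnerProductSpace ℂ H] (e : ι → H) : Prop :=
  ∃ A B : ℝ, 0 < A ∧ 0 < B ∧ ∀ f : H,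
    Summable (fun i => ‖inner ℂ (e i) f‖ ^ 2) ∧
    A * ‖f‖ ^ 2 ≤ ∑' i, ‖inner ℂ (e i) f‖ ^ 2 ∧
    ∑' i, ‖inner ℂ (e i) f‖ ^ 2 ≤ B * ‖f‖ ^ 2

/-- The family `e` is a Riesz sequence in `H`. -/
def IsRieszSequence {H ι : Type*} [NormedAddCommGroup H] [InnerProductSpace ℂ H]
    (e : ι → H) : Prop :=
  ∃ A B : ℝ, 0 < A ∧ 0 < B ∧ ∀ c : lp (fun _ : ι => ℂ) 2,
    Summable (fun i => c i • e i) ∧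
    A * ‖c‖ ^ 2 ≤ ‖∑' i, c i • e i‖ ^ 2 ∧
    ‖∑' i, c i • e i‖ ^ 2 ≤ B * ‖c‖ ^ 2

/-- The local maximal function `M_Q F (x) = sup_{z ∈ Q} |F (x z)|`, with values in `[0, ∞]`. -/
noncomputable def localMaximal {G : Type*} [Group G] (Q : Set G) (F : G → ℂ) (x : G) : ℝ≥0∞ :=
  ⨆ z ∈ Q, ‖F (x * z)‖ₑ

/-- A projective unitary representation of `G` on `H`: a strongly measurable map `π` into the
unitary operators with `π x ∘ π y = σ (x, y) • π (x y)` for a circle-valued function `σ`. -/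
structure ProjectiveRep (G H : Type*) [Group G] [MeasurableSpace G]
    [NormedAddCommGroup H] [InnerProductSpace ℂ H] where
  op : G → H ≃ₗᵢ[ℂ] H
  cocycle : G → G → Circle
  op_op : ∀ (x y : G) (v : H), op x (op y v) = (cocycle x y : ℂ) • op (x * y) v
  stronglyMeasurable : ∀ v : H, StronglyMeasurable (fun x => op x v)

namespace ProjectiveRep

/-- The coefficient transform `V_g f (x) = ⟨f, π(x) g⟩`, where the bracket is linear in the first
variable; Mathlib's `inner` is linear in the second one. -/
noncomputable def coeff {G H : Type*} [Group G] [MeasurableSpace G] [NormedAddCommGroup H]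
    [InnerProductSpace ℂ H] (π : ProjectiveRep G H) (g f : H) (x : G) : ℂ :=
  inner ℂ (π.op x g) f

/-- The only closed invariant subspaces are `0` and `H`. -/
def IsIrreducible {G H : Type*} [Group G] [MeasurableSpace G] [NormedAddCommGroup H]
    [InnerProductSpace ℂ H] (π : ProjectiveRep G H) : Prop :=
  ∀ W : Submodule ℂ H, IsClosed (W : Set H) → (∀ x, ∀ v ∈ W, π.op x v ∈ W) → W = ⊥ ∨ W = ⊤

/-- Projective discrete series: irreducible and square-integrable. -/
def IsDiscreteSeries {G H : Type*} [Group G] [MeasurableSpace G] [NormedAddCommGroup H]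
    [InnerProductSpace ℂ H] (π : ProjectiveRep G H) (μ : Measure G) : Prop :=
  π.IsIrreducible ∧ ∃ g : H, g ≠ 0 ∧ Integrable (fun x => ‖π.coeff g g x‖ ^ 2) μ

/-- `d` is the formal degree of `π`: it is positive and the orthogonality relations
`∫ ⟨f₁, π(x) g₁⟩ ⟨π(x) g₂, f₂⟩ dμ(x) = d⁻¹ ⟨f₁, f₂⟩ conj ⟨g₁, g₂⟩` hold (brackets linear in the
first variable, as in `coeff`), the integrals being absolutely convergent. -/
def IsFormalDegree {G H : Type*} [Group G] [MeasurableSpace G] [NormedAddCommGroup H]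
    [InnerProductSpace ℂ H] (π : ProjectiveRep G H) (μ : Measure G) (d : ℝ) : Prop :=
  0 < d ∧ ∀ f₁ f₂ g₁ g₂ : H,
    Integrable (fun x => π.coeff g₁ f₁ x * (starRingEnd ℂ) (π.coeff g₂ f₂ x)) μ ∧
    ∫ x, π.coeff g₁ f₁ x * (starRingEnd ℂ) (π.coeff g₂ f₂ x) ∂μ =
      (d : ℂ)⁻¹ * inner ℂ f₂ f₁ * (starRingEnd ℂ) (inner ℂ g₂ g₁)

/-- The set of localized vectors: those `g` for which `M_Q (V_g g)` is in `L²(G)`, where `Q` is a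
relatively compact symmetric unit neighborhood. The set does not depend on `Q`; membership for some
`Q` is required. -/
def localized {G H : Type*} [Group G] [TopologicalSpace G] [MeasurableSpace G]
    [NormedAddCommGroup H] [InnerProductSpace ℂ H] (π : ProjectiveRep G H) (μ : Measure G) :
    Set H :=
  {g | ∃ Q : Set G, Q ∈ 𝓝 (1 : G) ∧ IsCompact (closure Q) ∧ Q⁻¹ = Q ∧
    ∫⁻ x, localMaximal Q (π.coeff g g) x ^ 2 ∂μ < ∞}

end ProjectiveRep

end Coherent

/-!
The formal degree comes from Schur's lemma: for an admissible vector `g`, the graph inner product of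
the closed operator `V_g` represents that of `H` by a bounded operator commuting with `π`. This is a
scalar, so the form `(f₁, f₂) ↦ ∫ conj (V_g f₁) V_g f₂` is a multiple of the inner product.

For the densities, pair `π(Λ) g` with a dual family `h`: a dual frame, or a biorthogonal system of
the Riesz sequence. The kernel
`Φ x = ∑ₗ ⟨π(l) g, π(x) g⟩ ⟨π(x) g, h l⟩` equals `‖g‖²` for a frame and is at most `‖g‖²` for a
Riesz sequence, while the orthogonality relations give each term the integral
`d⁻¹ ‖g‖² ⟨π(l) g, h l⟩`, of modulus at most, respectively equal to, `d⁻¹ ‖g‖²`. Integrating `Φ`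
over `x K n` therefore compares `‖g‖² μ (K n)` with `d⁻¹ ‖g‖² #(Λ ∩ x K n)`. Since `g` is localized
and `Λ` is relatively separated, the error is concentrated near the boundary of `x K n`, so it is
`o(μ (K n))` uniformly in `x` by the Følner condition.

That the densities are limits follows from averaging the counting function `y ↦ #(Λ ∩ y K m)` over
`x K n`.
-/

namespace Coherent

open ProjectiveRep
open scoped NNReal

theorem exists_leftInverse_of_le_norm {E F : Type*} [NormedAddCommGroup E] [InnerProductSpace ℂ E]
    [CompleteSpace E] [NormedAddCommGroup F] [InnerProductSpace ℂ F] [CompleteSpace F]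
    (X : E →L[ℂ] F) {A : ℝ} (hA : 0 < A) (h : ∀ v, A * ‖v‖ ^ 2 ≤ ‖X v‖ ^ 2) :
    ∃ Y : F →L[ℂ] E, (∀ v, Y (X v) = v) ∧ ∀ w, ‖X (Y w)‖ ≤ ‖w‖ := by
  have hanti : AntilipschitzWith (Real.toNNReal (Real.sqrt A)⁻¹) X := by
    refine ContinuousLinearMap.antilipschitz_of_bound X fun v => ?_
    rw [Real.coe_toNNReal _ (by positivity), inv_mul_eq_div, le_div_iff₀ (Real.sqrt_pos.2 hA)]
    refine le_of_sq_le_sq ?_ (norm_nonneg _)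
    rw [mul_pow, Real.sq_sqrt hA.le, mul_comm]
    exact h v
  have hclosed := hanti.isClosed_range X.uniformContinuous
  have : CompleteSpace X.range := hclosed.completeSpace_coe
  let e := X.equivRange hanti.injective hclosed
  have hX (w : X.range) : X (e.symm w) = w := congrArg Subtype.val (e.apply_symm_apply w)
  refine ⟨(e.symm : X.range →L[ℂ] E) ∘L X.range.orthogonalProjectionOnto, fun v => ?_, fun w => ?_⟩
  · exact hanti.injective ((hX _).trans (Submodule.starProjection_eq_self_iff.2 ⟨v, rfl⟩))
  · exact (congrArg norm (hX _)).trans_le (X.range.norm_starProjection_apply_le w)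

theorem sesquilinear_eq_of_diagonal_eq {H : Type*} [AddCommGroup H] [Module ℂ H]
    (B C : H →ₗ[ℂ] H →ₗ⋆[ℂ] ℂ) (h : ∀ v, B v v = C v v) (u v : H) : B u v = C u v := by
  have h₁ := h (u + v)
  have h₂ := h (u + Complex.I • v)
  simp only [map_add, map_smul, LinearMap.add_apply, LinearMap.smul_apply, map_smulₛₗ,
    Complex.conj_I, smul_eq_mul, h u, h v] at h₁ h₂
  linear_combination (1 / 2 : ℂ) * h₁ + (1 / 2 : ℂ) * Complex.I * h₂ +
    (1 / 2 : ℂ) * (B u v - B v u + C v u - C u v) * Complex.I_mul_I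

section FunctionalCalculus

variable {A : Type*} [Ring A] [StarRing A] [TopologicalSpace A] [Algebra ℝ A]
  [ContinuousFunctionalCalculus ℝ A IsSelfAdjoint] {T : A}

theorem cfc_ne_zero_of_mem_spectrum (hT : IsSelfAdjoint T) {f : ℝ → ℝ} (hf : Continuous f) {a : ℝ}
    (ha : a ∈ spectrum ℝ T) (hfa : f a ≠ 0) : cfc f T ≠ 0 := fun h => by
  rw [← cfc_const_zero ℝ T] at h
  exact hfa ((cfc_eq_cfc_iff_eqOn hT hf.continuousOn continuousOn_const).1 h ha)

theorem exists_cfc_ne_zero_mul_eq_zero (hT : IsSelfAdjoint T) {a b : ℝ} (ha : a ∈ spectrum ℝ T)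
    (hb : b ∈ spectrum ℝ T) (hab : a < b) :
    ∃ f₁ f₂ : ℝ → ℝ, cfc f₁ T ≠ 0 ∧ cfc f₂ T ≠ 0 ∧ cfc f₁ T * cfc f₂ T = 0 := by
  have h₁ : Continuous fun t : ℝ => max ((a + b) / 2 - t) 0 := by fun_prop
  have h₂ : Continuous fun t : ℝ => max (t - (a + b) / 2) 0 := by fun_prop
  refine ⟨_, _, cfc_ne_zero_of_mem_spectrum hT h₁ ha (lt_max_of_lt_left ?_).ne',
    cfc_ne_zero_of_mem_spectrum hT h₂ hb (lt_max_of_lt_left ?_).ne', ?_⟩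
  · linarith
  · linarith
  rw [← cfc_mul _ _ T h₁.continuousOn h₂.continuousOn, ← cfc_const_zero ℝ T]
  refine cfc_congr fun t _ => ?_
  rcases le_total t ((a + b) / 2) with h | h
  · simp only [max_eq_right (sub_nonpos.2 h), mul_zero]
  · simp only [max_eq_right (sub_nonpos.2 h), zero_mul]

theorem exists_eq_algebraMap_of_spectrum_subsingleton [Nontrivial A] (hT : IsSelfAdjoint T)
    (h : (spectrum ℝ T).Subsingleton) : ∃ a : ℝ, T = algebraMap ℝ A a := by
  obtain ⟨a, ha⟩ : (spectrum ℝ T).Nonempty := ContinuousFunctionalCalculus.spectrum_nonempty T hT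
  refine ⟨a, ?_⟩
  calc T = cfc id T := (cfc_id ℝ T).symm
    _ = cfc (fun _ => a) T := cfc_congr fun b hb => h hb ha
    _ = algebraMap ℝ A a := cfc_const a T

end FunctionalCalculus

namespace ProjectiveRep

section Schur

variable {G H : Type*} [Group G] [MeasurableSpace G] [NormedAddCommGroup H]
  [InnerProductSpace ℂ H] {π : ProjectiveRep G H}

theorem IsIrreducible.ker_eq_bot (hπ : π.IsIrreducible) {T : H →L[ℂ] H}
    (hT : ∀ x v, T (π.op x v) = π.op x (T v)) (hT₀ : T ≠ 0) : T.ker = ⊥ := by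
  refine (hπ T.ker T.isClosed_ker fun x v hv => ?_).resolve_right fun h => hT₀ ?_
  · exact (hT x v).trans (by rw [show T v = 0 from hv, map_zero])
  · exact ContinuousLinearMap.ext fun v => show v ∈ T.ker from h ▸ Submodule.mem_top

theorem IsIrreducible.exists_eq_smul_of_isSelfAdjoint [CompleteSpace H] (hπ : π.IsIrreducible)
    {T : H →L[ℂ] H} (hT : IsSelfAdjoint T) (hc : ∀ x v, T (π.op x v) = π.op x (T v)) :
    ∃ c : ℝ, ∀ v, T v = (c : ℂ) • v := by
  rcases subsingleton_or_nontrivial H with hH | hH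
  · exact ⟨0, fun v => Subsingleton.elim _ _⟩
  have hcfc (f : ℝ → ℝ) (x : G) (v : H) : cfc f T (π.op x v) = π.op x (cfc f T v) := by
    have : Commute T ((π.op x).toContinuousLinearEquiv : H →L[ℂ] H) :=
      ContinuousLinearMap.ext (hc x)
    exact congrArg (fun S : H →L[ℂ] H => S v) (this.cfc_real f).eq
  have hsub : (spectrum ℝ T).Subsingleton := by
    refine Set.not_nontrivial_iff.1 fun h => ?_
    obtain ⟨a, ha, b, hb, hab⟩ := h.exists_lt
    obtain ⟨f₁, f₂, h₁, h₂, h₁₂⟩ := exists_cfc_ne_zero_mul_eq_zero hT ha hb hab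
    refine h₂ (ContinuousLinearMap.ext fun v => ?_)
    have hv : cfc f₂ T v ∈ (cfc f₁ T).ker := congrArg (fun S : H →L[ℂ] H => S v) h₁₂
    rwa [hπ.ker_eq_bot (hcfc f₁) h₁] at hv
  obtain ⟨c, hc⟩ := exists_eq_algebraMap_of_spectrum_subsingleton hT hsub
  refine ⟨c, fun v => ?_⟩
  rw [hc, Algebra.algebraMap_eq_smul_one]
  simp

end Schur

end ProjectiveRep

/-- The distribution of `ψ` charges a small ball of the separable space `X`; by Steinhaus, the
quotients of points of its preimage fill a neighborhood of `1`. -/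
theorem eventually_exists_div_eq_dist_lt {G X : Type*} [Group G] [TopologicalSpace G]
    [IsTopologicalGroup G] [LocallyCompactSpace G] [SecondCountableTopology G] [MeasurableSpace G]
    [BorelSpace G] (μ : Measure G) [μ.IsHaarMeasure] [PseudoMetricSpace X]
    [SecondCountableTopology X] [MeasurableSpace X] [OpensMeasurableSpace X] {ψ : G → X}
    (hψ : Measurable ψ) {r : ℝ} (hr : 0 < r) :
    ∀ᶠ u in 𝓝 (1 : G), ∃ x y, u = x / y ∧ dist (ψ y) (ψ x) < r := by
  obtain ⟨v, -, hv⟩ := exists_mem_forall_mem_nhdsWithin_pos_measure (μ := μ.map ψ)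
    (s := Set.univ) (by
      rw [Measure.map_apply hψ MeasurableSet.univ]
      exact (isOpen_univ.measure_pos μ Set.univ_nonempty).ne')
  have hball := hv _ (mem_nhdsWithin_of_mem_nhds (Metric.ball_mem_nhds v (half_pos hr)))
  rw [Measure.map_apply hψ measurableSet_ball] at hball
  filter_upwards [Measure.div_mem_nhds_one_of_haar_pos μ _ (hψ measurableSet_ball) hball]
    with u hu
  obtain ⟨x, hx, y, hy, rfl⟩ := hu
  refine ⟨x, y, rfl, ?_⟩
  calc dist (ψ y) (ψ x) ≤ dist (ψ y) v + dist (ψ x) v := dist_triangle_right _ _ _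
    _ < r := by linarith [Metric.mem_ball.1 hx, Metric.mem_ball.1 hy]

namespace ProjectiveRep

section Coeff

variable {G H : Type*} [Group G] [MeasurableSpace G] [NormedAddCommGroup H]
  [InnerProductSpace ℂ H] (π : ProjectiveRep G H)

theorem stronglyMeasurable_coeff (g f : H) : StronglyMeasurable (π.coeff g f) :=
  (π.stronglyMeasurable g).inner stronglyMeasurable_const

theorem coeff_add_right (g f₁ f₂ : H) (x : G) :
    π.coeff g (f₁ + f₂) x = π.coeff g f₁ x + π.coeff g f₂ x := inner_add_right _ _ _

theorem coeff_smul_right (g f : H) (c : ℂ) (x : G) :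
    π.coeff g (c • f) x = c * π.coeff g f x := inner_smul_right _ _ _

theorem coeff_add_left (g₁ g₂ f : H) (x : G) :
    π.coeff (g₁ + g₂) f x = π.coeff g₁ f x + π.coeff g₂ f x := by
  simp only [coeff, map_add, inner_add_left]

theorem coeff_smul_left (g f : H) (c : ℂ) (x : G) :
    π.coeff (c • g) f x = (starRingEnd ℂ) c * π.coeff g f x := by
  simp only [coeff, map_smul, inner_smul_left]

theorem norm_coeff_le (g f : H) (x : G) : ‖π.coeff g f x‖ ≤ ‖g‖ * ‖f‖ := by
  simpa only [coeff, LinearIsometryEquiv.norm_map] using norm_inner_le_norm (𝕜 := ℂ) (π.op x g) f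

theorem op_one (v : H) : π.op 1 v = (π.cocycle 1 1 : ℂ) • v := by
  obtain ⟨w, rfl⟩ := (π.op 1).surjective v
  simpa only [mul_one] using π.op_op 1 1 w

theorem coeff_op (g f : H) (y x : G) :
    π.coeff g (π.op y f) x = π.cocycle y (y⁻¹ * x) * π.coeff g f (y⁻¹ * x) := by
  have h : inner ℂ (π.op y (π.op (y⁻¹ * x) g)) (π.op y f) = π.coeff g f (y⁻¹ * x) :=
    (π.op y).inner_map_map _ _
  rw [π.op_op, mul_inv_cancel_left, inner_smul_left, ← Circle.coe_inv_eq_conj] at h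
  rw [← h, ← mul_assoc, ← Circle.coe_mul, mul_inv_cancel, Circle.coe_one, one_mul]
  rfl

theorem norm_coeff_op (g f : H) (y x : G) :
    ‖π.coeff g (π.op y f) x‖ = ‖π.coeff g f (y⁻¹ * x)‖ := by
  rw [coeff_op, norm_mul, Circle.norm_coe, one_mul]

theorem conj_coeff_op_mul (g f₁ f₂ : H) (y x : G) :
    (starRingEnd ℂ) (π.coeff g (π.op y f₁) x) * π.coeff g (π.op y f₂) x =
      (starRingEnd ℂ) (π.coeff g f₁ (y⁻¹ * x)) * π.coeff g f₂ (y⁻¹ * x) := by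
  have h : (starRingEnd ℂ) (π.cocycle y (y⁻¹ * x) : ℂ) * π.cocycle y (y⁻¹ * x) = 1 := by
    rw [← Circle.coe_inv_eq_conj, ← Circle.coe_mul, inv_mul_cancel, Circle.coe_one]
  rw [coeff_op, coeff_op, map_mul]
  linear_combination (starRingEnd ℂ) (π.coeff g f₁ (y⁻¹ * x)) * π.coeff g f₂ (y⁻¹ * x) * h

theorem norm_inner_op_op (g f : H) (x y : G) :
    ‖inner ℂ (π.op x (π.op y g)) f‖ = ‖π.coeff g f (x * y)‖ := by
  rw [op_op, inner_smul_left, norm_mul, RCLike.norm_conj, Circle.norm_coe, one_mul]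
  rfl

theorem norm_coeff_inv (g f : H) (x : G) : ‖π.coeff g f x⁻¹‖ = ‖π.coeff f g x‖ := by
  have h : inner ℂ (π.op x (π.op x⁻¹ g)) (π.op x f) = π.coeff g f x⁻¹ :=
    (π.op x).inner_map_map _ _
  rw [← h, op_op, mul_inv_cancel, op_one, smul_smul, ← Circle.coe_mul, inner_smul_left, norm_mul,
    RCLike.norm_conj, Circle.norm_coe, one_mul, norm_inner_symm]
  rfl

theorem norm_coeff_one (g f : H) : ‖π.coeff g f 1‖ = ‖inner ℂ g f‖ := by
  rw [coeff, op_one, inner_smul_left, norm_mul, RCLike.norm_conj, Circle.norm_coe, one_mul]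

theorem exists_norm_op_sub_smul_sq_eq (g : H) (u : G) :
    ∃ t : ℂ, ‖t‖ = 1 ∧ ‖π.op u g - t • g‖ ^ 2 = 2 * (‖g‖ ^ 2 - ‖π.coeff g g u‖) := by
  obtain ⟨t, ht, h⟩ : ∃ t : ℂ, ‖t‖ = 1 ∧ t * π.coeff g g u = ‖π.coeff g g u‖ := by
    by_cases h₀ : π.coeff g g u = 0
    · exact ⟨1, norm_one, by rw [h₀, mul_zero, norm_zero, Complex.ofReal_zero]⟩
    · refine ⟨‖π.coeff g g u‖ / π.coeff g g u, by simp [h₀], ?_⟩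
      field_simp
  refine ⟨t, ht, ?_⟩
  have hinner : RCLike.re (inner ℂ (π.op u g) (t • g)) = ‖π.coeff g g u‖ := by
    rw [inner_smul_right]
    exact congrArg Complex.re h
  rw [norm_sub_sq (𝕜 := ℂ), hinner, LinearIsometryEquiv.norm_map, norm_smul, ht, one_mul]
  ring

theorem abs_norm_coeff_mul_sub_norm_coeff_le (g f : H) (x u : G) :
    |‖π.coeff g f (x * u)‖ - ‖π.coeff g f x‖| ≤
      Real.sqrt (2 * (‖g‖ ^ 2 - ‖π.coeff g g u‖)) * ‖f‖ := by
  obtain ⟨t, ht, h⟩ := π.exists_norm_op_sub_smul_sq_eq g u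
  have hx : ‖π.coeff g f x‖ = ‖inner ℂ (π.op x (t • g)) f‖ := by
    rw [map_smul, inner_smul_left, norm_mul, RCLike.norm_conj, ht, one_mul]
    rfl
  rw [← h, Real.sqrt_sq (norm_nonneg _), hx, ← norm_inner_op_op]
  refine (abs_norm_sub_norm_le _ _).trans ?_
  rw [← inner_sub_left, ← map_sub]
  exact (norm_inner_le_norm _ _).trans_eq (by rw [LinearIsometryEquiv.norm_map])

end Coeff

section Continuity

variable {G H : Type*} [Group G] [TopologicalSpace G] [IsTopologicalGroup G]
  [LocallyCompactSpace G] [SecondCountableTopology G] [MeasurableSpace G] [BorelSpace G]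
  [NormedAddCommGroup H] [InnerProductSpace ℂ H] [TopologicalSpace.SeparableSpace H]
  (π : ProjectiveRep G H)

theorem tendsto_norm_coeff_self_one (μ : Measure G) [μ.IsHaarMeasure] (g : H) :
    Tendsto (fun u => ‖π.coeff g g u‖) (𝓝 1) (𝓝 (‖g‖ ^ 2)) := by
  borelize H
  let ψ : G → H := fun x => π.op x⁻¹ g
  have hψ : Measurable ψ := (π.stronglyMeasurable g).measurable.comp measurable_inv
  have hnorm x : ‖ψ x‖ = ‖g‖ := LinearIsometryEquiv.norm_map _ _
  have hcoeff x y : ‖inner ℂ (ψ y) (ψ x)‖ = ‖π.coeff g g (x / y)‖ := by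
    have h := π.norm_coeff_op g g x⁻¹ y⁻¹
    rwa [inv_inv, ← div_eq_mul_inv] at h
  have hsub x y : ‖g‖ ^ 2 - ‖π.coeff g g (x / y)‖ ≤ ‖g‖ * ‖ψ y - ψ x‖ := by
    calc ‖g‖ ^ 2 - ‖π.coeff g g (x / y)‖ = ‖inner ℂ (ψ y) (ψ y)‖ - ‖inner ℂ (ψ y) (ψ x)‖ := by
          rw [← hcoeff, inner_self_eq_norm_sq_to_K, hnorm, norm_pow, RCLike.norm_ofReal, abs_norm]
      _ ≤ ‖inner ℂ (ψ y) (ψ y - ψ x)‖ := by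
          rw [inner_sub_right]
          exact norm_sub_norm_le _ _
      _ ≤ ‖g‖ * ‖ψ y - ψ x‖ := hnorm y ▸ norm_inner_le_norm _ _
  rw [Metric.tendsto_nhds]
  intro ε hε
  obtain ⟨r, hr, hrε⟩ : ∃ r : ℝ, 0 < r ∧ ‖g‖ * r < ε := by
    refine ⟨ε / (‖g‖ + 1), by positivity, ?_⟩
    field_simp
    linarith
  filter_upwards [eventually_exists_div_eq_dist_lt μ hψ hr] with u hu
  obtain ⟨x, y, rfl, hxy⟩ := hu
  have hle : ‖π.coeff g g (x / y)‖ ≤ ‖g‖ ^ 2 := (π.norm_coeff_le g g _).trans_eq (sq _).symm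
  rw [Real.dist_eq, abs_sub_comm, abs_of_nonneg (sub_nonneg.2 hle)]
  calc ‖g‖ ^ 2 - ‖π.coeff g g (x / y)‖ ≤ ‖g‖ * ‖ψ y - ψ x‖ := hsub x y
    _ ≤ ‖g‖ * r := by
        rw [← dist_eq_norm]
        gcongr
    _ < ε := hrε

theorem continuous_norm_coeff (μ : Measure G) [μ.IsHaarMeasure] (g f : H) :
    Continuous fun x => ‖π.coeff g f x‖ := by
  refine continuous_iff_continuousAt.2 fun x => tendsto_iff_dist_tendsto_zero.2 ?_
  have hquot : Tendsto (fun y => x⁻¹ * y) (𝓝 x) (𝓝 1) := by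
    simpa only [inv_mul_cancel] using (continuous_const_mul x⁻¹).tendsto x
  have hsqrt := ((((π.tendsto_norm_coeff_self_one μ g).comp hquot).const_sub
    (‖g‖ ^ 2)).const_mul 2).sqrt.mul_const ‖f‖
  rw [sub_self, mul_zero, Real.sqrt_zero, zero_mul] at hsqrt
  refine squeeze_zero (fun _ => dist_nonneg) (fun y => ?_) hsqrt
  simpa only [Real.dist_eq, mul_inv_cancel_left, Function.comp_apply] using
    π.abs_norm_coeff_mul_sub_norm_coeff_le g f x (x⁻¹ * y)

end Continuity

section SquareIntegrable

variable {G H : Type*} [Group G] [MeasurableSpace G] [NormedAddCommGroup H]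
  [InnerProductSpace ℂ H] (π : ProjectiveRep G H) (μ : Measure G)

/-- The domain of the coefficient transform of `g` as an unbounded operator from `H` to `L²(G)`:
the vectors `f` for which `V_g f` is square integrable. -/
def sqIntegrable (g : H) : Submodule ℂ H where
  carrier := {f | MemLp (π.coeff g f) 2 μ}
  add_mem' {a b} ha hb := by
    refine (MemLp.add ha hb).congr_norm (π.stronglyMeasurable_coeff _ _).aestronglyMeasurable ?_
    exact Eventually.of_forall fun x => by rw [Pi.add_apply, coeff_add_right]
  zero_mem' := by
    have h : π.coeff g 0 = 0 := funext fun x => inner_zero_right _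
    change MemLp (π.coeff g 0) 2 μ
    exact h ▸ MemLp.zero
  smul_mem' c f hf := by
    refine (MemLp.const_smul hf c).congr_norm
      (π.stronglyMeasurable_coeff _ _).aestronglyMeasurable ?_
    exact Eventually.of_forall fun x => by rw [Pi.smul_apply, coeff_smul_right, smul_eq_mul]

theorem mem_sqIntegrable {g f : H} : f ∈ π.sqIntegrable μ g ↔ MemLp (π.coeff g f) 2 μ := Iff.rfl

theorem op_mem_sqIntegrable [MeasurableMul G] [μ.IsMulLeftInvariant] {g f : H} (y : G)
    (hf : f ∈ π.sqIntegrable μ g) : π.op y f ∈ π.sqIntegrable μ g := by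
  rw [mem_sqIntegrable] at hf ⊢
  refine (hf.comp_measurePreserving (measurePreserving_mul_left μ y⁻¹)).congr_norm
    (π.stronglyMeasurable_coeff _ _).aestronglyMeasurable ?_
  exact Eventually.of_forall fun x => (π.norm_coeff_op _ _ _ _).symm

theorem exists_op_eq_of_mem_sqIntegrable [MeasurableMul G] [μ.IsMulLeftInvariant] {g f : H}
    (y : G) (hf : f ∈ π.sqIntegrable μ g) : ∃ f' ∈ π.sqIntegrable μ g, π.op y f' = f := by
  obtain ⟨f', rfl⟩ := (π.op y).surjective f
  have h := π.op_mem_sqIntegrable μ y⁻¹ hf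
  rw [op_op, inv_mul_cancel, op_one, smul_smul, ← Circle.coe_mul] at h
  exact ⟨f', ((π.sqIntegrable μ g).smul_mem_iff (Circle.coe_ne_zero _)).1 h, rfl⟩

/-- The graph of the coefficient transform `f ↦ V_g f`, inside `H × L²(G)`. -/
def coeffGraph (g : H) : Submodule ℂ (WithLp 2 (H × Lp ℂ 2 μ)) where
  carrier := {p | p.snd =ᵐ[μ] π.coeff g p.fst}
  add_mem' {a b} ha hb := by
    simp only [Set.mem_ofPred_eq, WithLp.add_snd, WithLp.add_fst] at *
    filter_upwards [ha, hb, Lp.coeFn_add a.snd b.snd] with x h₁ h₂ h₃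
    rw [h₃, Pi.add_apply, h₁, h₂, coeff_add_right]
  zero_mem' := by
    simp only [Set.mem_ofPred_eq, WithLp.zero_snd, WithLp.zero_fst]
    filter_upwards [Lp.coeFn_zero ℂ 2 μ] with x h
    exact h.trans (inner_zero_right _).symm
  smul_mem' c a ha := by
    simp only [Set.mem_ofPred_eq, WithLp.smul_snd, WithLp.smul_fst] at *
    filter_upwards [ha, Lp.coeFn_smul c a.snd] with x h₁ h₂
    rw [h₂, Pi.smul_apply, h₁, coeff_smul_right, smul_eq_mul]

theorem isClosed_coeffGraph (g : H) :
    IsClosed (π.coeffGraph μ g : Set (WithLp 2 (H × Lp ℂ 2 μ))) := by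
  refine IsSeqClosed.isClosed fun p q hp hpq => ?_
  have hfst : Tendsto (fun n => (p n).fst) atTop (𝓝 q.fst) :=
    ((WithLp.fstL 2 ℂ H (Lp ℂ 2 μ)).continuous.tendsto q).comp hpq
  have hsnd : Tendsto (fun n => (p n).snd) atTop (𝓝 q.snd) :=
    ((WithLp.sndL 2 ℂ H (Lp ℂ 2 μ)).continuous.tendsto q).comp hpq
  obtain ⟨ns, hns, hae⟩ := (tendstoInMeasure_of_tendsto_Lp hsnd).exists_seq_tendsto_ae
  have hall : ∀ᵐ x ∂μ, ∀ n, (p n).snd x = π.coeff g (p n).fst x :=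
    ae_all_iff.2 fun n => hp n
  change q.snd =ᵐ[μ] π.coeff g q.fst
  filter_upwards [hae, hall] with x hx hx'
  refine tendsto_nhds_unique hx ?_
  simp only [hx']
  exact (tendsto_const_nhds (x := π.op x g)).inner (hfst.comp hns.tendsto_atTop)

theorem mem_sqIntegrable_iff_exists_mem_coeffGraph {g f : H} :
    f ∈ π.sqIntegrable μ g ↔ ∃ p ∈ π.coeffGraph μ g, p.fst = f := by
  constructor
  · exact fun hf => ⟨WithLp.toLp 2 (f, MemLp.toLp _ hf), MemLp.coeFn_toLp hf, rfl⟩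
  · rintro ⟨p, hp, rfl⟩
    exact (memLp_congr_ae hp).1 (Lp.memLp _)

/-- The inner product of the graph of `V_g`, transported to the domain `sqIntegrable` of `V_g`. -/
noncomputable def graphInner (g f₁ f₂ : H) : ℂ :=
  inner ℂ f₁ f₂ + ∫ x, (starRingEnd ℂ) (π.coeff g f₁ x) * π.coeff g f₂ x ∂μ

theorem inner_eq_graphInner {g : H} (p q : π.coeffGraph μ g) :
    inner ℂ p q = π.graphInner μ g p.1.fst q.1.fst := by
  rw [Submodule.coe_inner, WithLp.prod_inner_apply, L2.inner_def]
  refine congrArg _ (integral_congr_ae ?_)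
  filter_upwards [p.2, q.2] with x hp hq
  rw [RCLike.inner_apply', ← hp, ← hq]
  rfl

theorem graphInner_op_op [MeasurableMul G] [μ.IsMulLeftInvariant] (g f₁ f₂ : H) (y : G) :
    π.graphInner μ g (π.op y f₁) (π.op y f₂) = π.graphInner μ g f₁ f₂ := by
  simp only [graphInner, LinearIsometryEquiv.inner_map_map, conj_coeff_op_mul]
  rw [integral_mul_left_eq_self
    (fun x => (starRingEnd ℂ) (π.coeff g f₁ x) * π.coeff g f₂ x) y⁻¹]

theorem eq_of_forall_graphInner_eq {g u v : H} (hu : u ∈ π.sqIntegrable μ g)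
    (hv : v ∈ π.sqIntegrable μ g)
    (h : ∀ f ∈ π.sqIntegrable μ g, π.graphInner μ g f u = π.graphInner μ g f v) : u = v := by
  obtain ⟨p, hp, rfl⟩ := (π.mem_sqIntegrable_iff_exists_mem_coeffGraph μ).1 hu
  obtain ⟨q, hq, rfl⟩ := (π.mem_sqIntegrable_iff_exists_mem_coeffGraph μ).1 hv
  suffices hpq : (⟨p, hp⟩ : π.coeffGraph μ g) = ⟨q, hq⟩ by rw [Subtype.mk.inj hpq]
  refine ext_inner_left ℂ fun r => ?_
  rw [inner_eq_graphInner, inner_eq_graphInner]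
  exact h _ ((π.mem_sqIntegrable_iff_exists_mem_coeffGraph μ).2 ⟨r, r.2, rfl⟩)

theorem exists_graphInner_apply_eq_inner [CompleteSpace H] (g : H) :
    ∃ T : H →L[ℂ] H, IsSelfAdjoint T ∧ (∀ h, T h ∈ π.sqIntegrable μ g) ∧
      ∀ h, ∀ f ∈ π.sqIntegrable μ g, π.graphInner μ g f (T h) = inner ℂ f h := by
  have : CompleteSpace (π.coeffGraph μ g) := (π.isClosed_coeffGraph μ g).completeSpace_coe
  let j : π.coeffGraph μ g →L[ℂ] H :=
    (WithLp.fstL 2 ℂ H (Lp ℂ 2 μ)) ∘L (π.coeffGraph μ g).subtypeL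
  refine ⟨j ∘L ContinuousLinearMap.adjoint j, ?_, fun h => ?_, fun h f hf => ?_⟩
  · rw [ContinuousLinearMap.isSelfAdjoint_iff', ContinuousLinearMap.adjoint_comp,
      ContinuousLinearMap.adjoint_adjoint]
  · exact (π.mem_sqIntegrable_iff_exists_mem_coeffGraph μ).2 ⟨_, (j.adjoint h).2, rfl⟩
  · obtain ⟨p, hp, rfl⟩ := (π.mem_sqIntegrable_iff_exists_mem_coeffGraph μ).1 hf
    exact (π.inner_eq_graphInner μ ⟨p, hp⟩ (j.adjoint h)).symm.trans
      (j.adjoint_inner_right ⟨p, hp⟩ h)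

variable {π}

theorem IsIrreducible.orthogonal_eq_bot [CompleteSpace H] (hπ : π.IsIrreducible)
    {W : Submodule ℂ H} (hW : ∀ x, ∀ v ∈ W, π.op x v ∈ W) (hne : W ≠ ⊥) : Wᗮ = ⊥ := by
  rw [← Submodule.topologicalClosure_eq_top_iff]
  refine (hπ _ W.isClosed_topologicalClosure fun x v hv => ?_).resolve_left fun h => ?_
  · exact map_mem_closure (π.op x).continuous hv (hW x)
  · exact hne (le_bot_iff.1 (h ▸ W.le_topologicalClosure))

/-- The operator `T` representing the inner product of `H` in the graph norm of `V_g` commutes with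
`π`, so it is a scalar by Schur's lemma; hence `V_g` is everywhere defined and a multiple of an
isometry. -/
theorem IsIrreducible.exists_integral_coeff_eq [CompleteSpace H] [MeasurableMul G]
    [μ.IsMulLeftInvariant] (hπ : π.IsIrreducible) {g f₀ : H} (hf₀ : f₀ ≠ 0)
    (hmem : f₀ ∈ π.sqIntegrable μ g) :
    ∃ c : ℝ, ∀ f, f ∈ π.sqIntegrable μ g ∧
      ∀ f', ∫ x, (starRingEnd ℂ) (π.coeff g f' x) * π.coeff g f x ∂μ = c * inner ℂ f' f := by
  obtain ⟨T, hsa, hTmem, hT⟩ := π.exists_graphInner_apply_eq_inner μ g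
  have hcomm (y : G) (v : H) : T (π.op y v) = π.op y (T v) := by
    refine π.eq_of_forall_graphInner_eq μ (hTmem _) (π.op_mem_sqIntegrable μ y (hTmem v))
      fun f hf => ?_
    obtain ⟨f', hf', rfl⟩ := π.exists_op_eq_of_mem_sqIntegrable μ y hf
    rw [hT _ _ hf, graphInner_op_op, hT v f' hf', LinearIsometryEquiv.inner_map_map]
  obtain ⟨c, hc⟩ := hπ.exists_eq_smul_of_isSelfAdjoint hsa hcomm
  have hbot := hπ.orthogonal_eq_bot (fun x _ hv => π.op_mem_sqIntegrable μ x hv)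
    (Submodule.ne_bot_iff _ |>.2 ⟨f₀, hmem, hf₀⟩)
  have hc₀ : (c : ℂ) ≠ 0 := fun h₀ => by
    have h : f₀ ∈ (π.sqIntegrable μ g)ᗮ := (Submodule.mem_orthogonal _ _).2 fun f hf => by
      rw [← hT f₀ f hf, hc, h₀]
      simp [graphInner, coeff]
    exact hf₀ ((Submodule.mem_bot ℂ).1 (hbot ▸ h))
  have hall (f : H) : f ∈ π.sqIntegrable μ g :=
    ((π.sqIntegrable μ g).smul_mem_iff hc₀).1 (hc f ▸ hTmem f)
  refine ⟨c⁻¹ - 1, fun f => ⟨hall f, fun f' => ?_⟩⟩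
  have h := hT f f' (hall f')
  simp only [graphInner, hc, coeff_smul_right, inner_smul_right, mul_left_comm _ (c : ℂ)] at h
  rw [integral_const_mul] at h
  push_cast
  field_simp
  linear_combination h

end SquareIntegrable

end ProjectiveRep

section Unimodular

variable {G : Type*} [Group G] [TopologicalSpace G] [IsTopologicalGroup G]
  [LocallyCompactSpace G] [SecondCountableTopology G] [MeasurableSpace G] [BorelSpace G]

/-- Inversion maps `μ` to a multiple `c • μ`, and it is an involution, so `c ^ 2 = 1`. -/
theorem isInvInvariant_of_isMulRightInvariant (μ : Measure G) [μ.IsHaarMeasure]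
    [μ.IsMulRightInvariant] : μ.IsInvInvariant := by
  let c : ℝ≥0∞ := Measure.haarScalarFactor μ.inv μ
  have hinv : μ.inv = c • μ := Measure.isMulLeftInvariant_eq_smul μ.inv μ
  have hsq : μ = c ^ 2 • μ := by
    calc μ = μ.inv.inv := μ.inv_inv.symm
      _ = c • μ.inv := by rw [hinv, Measure.inv_def, Measure.map_smul, ← Measure.inv_def, hinv]
      _ = c ^ 2 • μ := by rw [hinv, smul_smul, sq]
  have K : TopologicalSpace.PositiveCompacts G := Classical.arbitrary _
  have hK : c ^ 2 * μ K = 1 ^ 2 * μ K := by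
    conv_rhs => rw [hsq]
    rw [one_pow, one_mul, Measure.smul_apply, smul_eq_mul]
  have hc : c ^ 2 = 1 ^ 2 :=
    (ENNReal.mul_left_inj (Measure.measure_pos_of_nonempty_interior _ K.interior_nonempty).ne'
      K.isCompact.measure_lt_top.ne).1 hK
  exact ⟨by rw [hinv, (ENNReal.pow_right_strictMono two_ne_zero).injective hc, one_smul]⟩

end Unimodular

namespace ProjectiveRep

section FormalDegree

variable {G H : Type*} [Group G] [MeasurableSpace G] [NormedAddCommGroup H]
  [InnerProductSpace ℂ H] (π : ProjectiveRep G H) (μ : Measure G)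

theorem integral_conj_coeff_mul_coeff_self (g f : H) :
    ∫ x, (starRingEnd ℂ) (π.coeff g f x) * π.coeff g f x ∂μ =
      ((∫ x, ‖π.coeff g f x‖ ^ 2 ∂μ : ℝ) : ℂ) := by
  rw [← integral_complex_ofReal]
  exact integral_congr_ae (Eventually.of_forall fun x => by
    simp only [RCLike.conj_mul]
    norm_cast)

variable {π μ}

theorem integrable_coeff_mul_conj_coeff (hmem : ∀ g f, MemLp (π.coeff g f) 2 μ)
    (f₁ f₂ g₁ g₂ : H) :
    Integrable (fun x => π.coeff g₁ f₁ x * (starRingEnd ℂ) (π.coeff g₂ f₂ x)) μ :=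
  (hmem g₁ f₁).integrable_mul ((hmem g₂ f₂).congr_norm (continuous_star.comp_stronglyMeasurable
    (π.stronglyMeasurable_coeff g₂ f₂)).aestronglyMeasurable
    (Eventually.of_forall fun _ => (RCLike.norm_conj _).symm))

theorem integral_coeff_mul_conj_coeff_eq (hmem : ∀ g f, MemLp (π.coeff g f) 2 μ) {C : ℝ}
    (hC : ∀ g f₁ f₂, ∫ x, (starRingEnd ℂ) (π.coeff g f₂ x) * π.coeff g f₁ x ∂μ =
      ((C * ‖g‖ ^ 2 : ℝ) : ℂ) * inner ℂ f₂ f₁) (f₁ f₂ g₁ g₂ : H) :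
    ∫ x, π.coeff g₁ f₁ x * (starRingEnd ℂ) (π.coeff g₂ f₂ x) ∂μ =
      C * inner ℂ f₂ f₁ * (starRingEnd ℂ) (inner ℂ g₂ g₁) := by
  have hint := integrable_coeff_mul_conj_coeff hmem
  let B : H →ₗ[ℂ] H →ₗ⋆[ℂ] ℂ := LinearMap.mk₂'ₛₗ (RingHom.id ℂ) (starRingEnd ℂ)
    (fun u v => ∫ x, π.coeff v f₁ x * (starRingEnd ℂ) (π.coeff u f₂ x) ∂μ)
    (fun u u' v => by
      rw [← integral_add (hint _ _ _ _) (hint _ _ _ _)]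
      simp only [coeff_add_left, map_add, mul_add])
    (fun a u v => by
      simp only [coeff_smul_left, map_mul, RCLike.conj_conj, RingHom.id_apply, smul_eq_mul,
        mul_left_comm _ a, integral_const_mul])
    (fun u v v' => by
      rw [← integral_add (hint _ _ _ _) (hint _ _ _ _)]
      simp only [coeff_add_left, add_mul])
    (fun a u v => by
      simp only [coeff_smul_left, mul_assoc, smul_eq_mul, integral_const_mul])
  let S : H →ₗ[ℂ] H →ₗ⋆[ℂ] ℂ := LinearMap.mk₂'ₛₗ (RingHom.id ℂ) (starRingEnd ℂ)
    (fun u v => C * inner ℂ f₂ f₁ * inner ℂ v u)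
    (fun u u' v => by rw [inner_add_right, mul_add])
    (fun a u v => by rw [inner_smul_right, mul_left_comm]; rfl)
    (fun u v v' => by rw [inner_add_left, mul_add])
    (fun a u v => by rw [inner_smul_left, mul_left_comm]; rfl)
  have hdiag (v : H) : B v v = S v v := by
    simp only [B, S, LinearMap.mk₂'ₛₗ_apply, mul_comm (π.coeff v f₁ _), hC,
      inner_self_eq_norm_sq_to_K, Complex.coe_algebraMap]
    push_cast
    ring
  rw [inner_conj_symm]
  exact sesquilinear_eq_of_diagonal_eq B S hdiag g₂ g₁

theorem IsFormalDegree.eq [Nontrivial H] {d d' : ℝ} (hd : π.IsFormalDegree μ d)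
    (hd' : π.IsFormalDegree μ d') : d = d' := by
  obtain ⟨v, hv⟩ := exists_ne (0 : H)
  have h := (hd.2 v v v v).2.symm.trans (hd'.2 v v v v).2
  have hvv : inner ℂ v v ≠ 0 := inner_self_ne_zero.2 hv
  rw [inner_conj_symm] at h
  exact_mod_cast inv_injective (mul_right_cancel₀ hvv (mul_right_cancel₀ hvv h))

variable [TopologicalSpace G] [IsTopologicalGroup G] [LocallyCompactSpace G]
  [SecondCountableTopology G] [BorelSpace G] [μ.IsHaarMeasure]

theorem integral_norm_coeff_self_sq_pos [TopologicalSpace.SeparableSpace H] {g : H} (hg : g ≠ 0)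
    (hmem : MemLp (π.coeff g g) 2 μ) : 0 < ∫ x, ‖π.coeff g g x‖ ^ 2 ∂μ := by
  have hcont : Continuous fun x => ‖π.coeff g g x‖ ^ 2 := (π.continuous_norm_coeff μ g g).pow 2
  rw [integral_pos_iff_support_of_nonneg (fun x => sq_nonneg _)
    ((memLp_two_iff_integrable_sq_norm hmem.1).1 hmem)]
  refine hcont.isOpen_support.measure_pos μ ⟨1, ?_⟩
  rw [Function.mem_support, norm_coeff_one]
  exact pow_ne_zero 2 (norm_ne_zero_iff.2 (inner_self_ne_zero.2 hg))

variable [μ.IsMulRightInvariant]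

theorem sqIntegrable_symm {g f : H} (h : f ∈ π.sqIntegrable μ g) : g ∈ π.sqIntegrable μ f := by
  have := isInvInvariant_of_isMulRightInvariant μ
  rw [mem_sqIntegrable] at h ⊢
  refine (h.comp_measurePreserving (Measure.measurePreserving_inv μ)).congr_norm
    (π.stronglyMeasurable_coeff _ _).aestronglyMeasurable ?_
  exact Eventually.of_forall fun x => π.norm_coeff_inv _ _ _

variable (π μ) in
theorem integral_norm_coeff_sq_symm (g f : H) :
    ∫ x, ‖π.coeff g f x‖ ^ 2 ∂μ = ∫ x, ‖π.coeff f g x‖ ^ 2 ∂μ := by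
  have := isInvInvariant_of_isMulRightInvariant μ
  rw [← integral_inv_eq_self]
  simp only [norm_coeff_inv]

theorem IsDiscreteSeries.exists_integral_coeff_eq [CompleteSpace H]
    [TopologicalSpace.SeparableSpace H] (hπ : π.IsDiscreteSeries μ) :
    ∃ C : ℝ, 0 < C ∧ ∀ g f, MemLp (π.coeff g f) 2 μ ∧
      ∀ f', ∫ x, (starRingEnd ℂ) (π.coeff g f' x) * π.coeff g f x ∂μ =
        ((C * ‖g‖ ^ 2 : ℝ) : ℂ) * inner ℂ f' f := by
  obtain ⟨hirr, g₀, hg₀, hint⟩ := hπ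
  obtain ⟨c₀, hc₀⟩ := hirr.exists_integral_coeff_eq μ hg₀ ((memLp_two_iff_integrable_sq_norm
    (π.stronglyMeasurable_coeff _ _).aestronglyMeasurable).2 hint)
  choose c hc using fun g => hirr.exists_integral_coeff_eq μ hg₀ (sqIntegrable_symm (hc₀ g).1)
  have hnorm (g f : H) : ∫ x, ‖π.coeff g f x‖ ^ 2 ∂μ = c g * ‖f‖ ^ 2 := by
    have h := (hc g f).2 f
    rw [integral_conj_coeff_mul_coeff_self, inner_self_eq_norm_sq_to_K] at h
    exact Complex.ofReal_injective (h.trans (by push_cast; rfl))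
  have hg₀' : 0 < ‖g₀‖ ^ 2 := by positivity
  have hpos : 0 < c g₀ := by
    have h := integral_norm_coeff_self_sq_pos hg₀ (hc g₀ g₀).1
    rw [hnorm] at h
    exact (mul_pos_iff_of_pos_right hg₀').1 h
  refine ⟨c g₀ / ‖g₀‖ ^ 2, by positivity, fun g f => ⟨(hc g f).1, fun f' => ?_⟩⟩
  have hcg : c g = c g₀ / ‖g₀‖ ^ 2 * ‖g‖ ^ 2 := by
    have h := integral_norm_coeff_sq_symm π μ g g₀
    rw [hnorm, hnorm] at h
    field_simp
    exact h
  rw [← hcg]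
  exact (hc g f).2 f'

theorem IsDiscreteSeries.existsUnique_isFormalDegree [CompleteSpace H]
    [TopologicalSpace.SeparableSpace H] (hπ : π.IsDiscreteSeries μ) :
    ∃! d : ℝ, π.IsFormalDegree μ d := by
  obtain ⟨C, hC, h⟩ := hπ.exists_integral_coeff_eq
  obtain ⟨-, g₀, hg₀, -⟩ := hπ
  have : Nontrivial H := ⟨g₀, 0, hg₀⟩
  have hmem (g f : H) : MemLp (π.coeff g f) 2 μ := (h g f).1
  have hdeg : π.IsFormalDegree μ C⁻¹ := by
    refine ⟨inv_pos.2 hC, fun f₁ f₂ g₁ g₂ => ⟨integrable_coeff_mul_conj_coeff hmem _ _ _ _, ?_⟩⟩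
    rw [Complex.ofReal_inv, inv_inv]
    exact integral_coeff_mul_conj_coeff_eq hmem (fun g f₁ f₂ => (h g f₁).2 f₂) f₁ f₂ g₁ g₂
  exact ⟨C⁻¹, hdeg, fun d hd => hd.eq hdeg⟩

end FormalDegree

end ProjectiveRep

section Bessel

variable {H ι : Type*} [NormedAddCommGroup H] [InnerProductSpace ℂ H]

/-- `B` is a Bessel bound of the family `e`. The sum has values in `[0, ∞]`, so no summability has
to be assumed. -/
def HasBesselBound (e : ι → H) (B : ℝ≥0) : Prop :=
  ∀ f : H, ∑' i, ‖inner ℂ (e i) f‖ₑ ^ 2 ≤ B * ‖f‖ₑ ^ 2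

theorem HasBesselBound.enorm_sq_le {e : ι → H} {B : ℝ≥0} (h : HasBesselBound e B) (i : ι) :
    ‖e i‖ₑ ^ 2 ≤ B := by
  by_cases h₀ : e i = 0
  · simp [h₀]
  have hself : ‖inner ℂ (e i) (e i)‖ₑ = ‖e i‖ₑ ^ 2 := by
    rw [inner_self_eq_norm_sq_to_K, enorm_pow, ← ofReal_norm, RCLike.norm_ofReal, abs_norm,
      ofReal_norm]
  have hle := (ENNReal.le_tsum i).trans (h (e i))
  rw [hself, sq (‖e i‖ₑ ^ 2)] at hle
  exact (ENNReal.mul_le_mul_iff_left (pow_ne_zero 2 (enorm_ne_zero.2 h₀))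
    (ENNReal.pow_ne_top enorm_ne_top)).1 hle

end Bessel

section UnitWindow

variable {G : Type*} [Group G] [TopologicalSpace G]

/-- An open, symmetric, relatively compact neighborhood of the identity. -/
structure IsUnitWindow (U : Set G) : Prop where
  isOpen : IsOpen U
  one_mem : 1 ∈ U
  inv_eq : U⁻¹ = U
  isCompact_closure : IsCompact (closure U)

namespace IsUnitWindow

variable {U : Set G}

theorem mem_nhds (hU : IsUnitWindow U) : U ∈ 𝓝 1 := hU.isOpen.mem_nhds hU.one_mem

theorem subset_mul (hU : IsUnitWindow U) (S : Set G) : S ⊆ S * U :=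
  Set.subset_mul_left S hU.one_mem

theorem measure_ne_zero [MeasurableSpace G] (hU : IsUnitWindow U) (μ : Measure G)
    [μ.IsOpenPosMeasure] : μ U ≠ 0 :=
  (hU.isOpen.measure_pos μ ⟨1, hU.one_mem⟩).ne'

theorem measure_ne_top [MeasurableSpace G] (hU : IsUnitWindow U) (μ : Measure G)
    [IsFiniteMeasureOnCompacts μ] : μ U ≠ ∞ :=
  ((measure_mono subset_closure).trans_lt hU.isCompact_closure.measure_lt_top).ne

end IsUnitWindow

theorem exists_isUnitWindow_subset [IsTopologicalGroup G] [LocallyCompactSpace G] {V : Set G}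
    (hV : V ∈ 𝓝 (1 : G)) : ∃ U ⊆ V, IsUnitWindow U := by
  obtain ⟨W, hW, hW₁⟩ := exists_compact_mem_nhds (1 : G)
  have hVW : interior (V ∩ W) ∈ 𝓝 (1 : G) := interior_mem_nhds.2 (inter_mem hV hW₁)
  have hsub : interior (V ∩ W) ∩ (interior (V ∩ W))⁻¹ ⊆ V ∩ W :=
    Set.inter_subset_left.trans interior_subset
  refine ⟨_, hsub.trans Set.inter_subset_left, isOpen_interior.inter isOpen_interior.inv,
    ⟨mem_of_mem_nhds hVW, ?_⟩, ?_, hW.closure_of_subset (hsub.trans Set.inter_subset_right)⟩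
  · rw [Set.mem_inv, inv_one]
    exact mem_of_mem_nhds hVW
  · rw [Set.inter_inv, inv_inv, Set.inter_comm]

end UnitWindow

theorem tsum_indicator_one {α : Type*} (Λ A : Set α) :
    ∑' l : Λ, A.indicator (1 : α → ℝ≥0∞) l = ((Λ ∩ A).encard : ℝ≥0∞) := by
  rw [tsum_subtype Λ (A.indicator 1), Set.indicator_indicator, ← tsum_subtype]
  exact ENNReal.tsum_set_one _

theorem indicator_smul_inv_one {G : Type*} [Group G] (U : Set G) (x y : G) :
    (x • U⁻¹).indicator (1 : G → ℝ≥0∞) y = (y • U).indicator 1 x := by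
  by_cases h : x ∈ y • U
  · rw [Set.indicator_of_mem h, Set.indicator_of_mem (Set.mem_smul_set_inv.2 h)]
    rfl
  · rw [Set.indicator_of_notMem h, Set.indicator_of_notMem (mt Set.mem_smul_set_inv.1 h)]

section Separated

/-- `Λ` has at most `N` points in each left translate of `U`: a quantitative form of relative
separation. -/
def IsSeparated {G : Type*} [Group G] (Λ U : Set G) (N : ℕ) : Prop :=
  ∀ x : G, (Λ ∩ x • U).encard ≤ N

namespace IsSeparated

variable {G : Type*} [Group G] {Λ U : Set G} {N : ℕ}

theorem mono (h : IsSeparated Λ U N) {V : Set G} (hV : V ⊆ U) : IsSeparated Λ V N := fun x =>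
  (Set.encard_le_encard (Set.inter_subset_inter_right _ (Set.smul_set_mono hV))).trans (h x)

variable [TopologicalSpace G] [IsTopologicalGroup G]

theorem countable [SecondCountableTopology G] (h : IsSeparated Λ U N) (hU : U ∈ 𝓝 (1 : G)) :
    Λ.Countable := by
  obtain ⟨s, hs, hcov⟩ := TopologicalSpace.countable_cover_nhds (f := fun x : G => x • U)
    fun x => by simpa only [smul_eq_mul, mul_one] using smul_mem_nhds_smul x hU
  have hΛ : Λ ⊆ ⋃ x ∈ s, Λ ∩ x • U := by
    rw [← Set.inter_iUnion₂, hcov, Set.inter_univ]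
  exact (hs.biUnion fun x _ => (Set.finite_of_encard_le_coe (h x)).countable).mono hΛ

theorem finite_inter_isCompact {K : Set G} (h : IsSeparated Λ U N) (hU : U ∈ 𝓝 (1 : G))
    (hK : IsCompact K) : (Λ ∩ K).Finite := by
  obtain ⟨t, -, ht⟩ := hK.elim_nhds_subcover (fun x => x • U)
    fun x _ => by simpa only [smul_eq_mul, mul_one] using smul_mem_nhds_smul x hU
  refine (t.finite_toSet.biUnion fun x _ => Set.finite_of_encard_le_coe (h x)).subset ?_
  rintro y ⟨hy, hyK⟩
  obtain ⟨x, hx, hxy⟩ := Set.mem_iUnion₂.1 (ht hyK)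
  exact Set.mem_biUnion hx ⟨hy, hxy⟩

variable [SecondCountableTopology G] [MeasurableSpace G] [BorelSpace G]

theorem tsum_indicator_le (h : IsSeparated Λ U N) (hU : IsUnitWindow U) (μ : Measure G)
    [μ.IsHaarMeasure] (S : Set G) {F M : G → ℝ≥0∞} (hM : Measurable M)
    (hFM : ∀ l, ∀ u ∈ U, F l ≤ M (l * u)) :
    ∑' l : Λ, S.indicator F l ≤ N / μ U * ∫⁻ y in S * U, M y ∂μ := by
  have := (h.countable hU.mem_nhds).to_subtype
  have hlU (l : G) : MeasurableSet (l • U) := (hU.isOpen.smul l).measurableSet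
  have hterm (l : G) : S.indicator F l * μ (l • U) ≤
      ∫⁻ y in S * U, (l • U).indicator M y ∂μ := by
    by_cases hl : l ∈ S
    · rw [Set.indicator_of_mem hl, lintegral_indicator (hlU l), Measure.restrict_restrict (hlU l),
        Set.inter_eq_left.2 (Set.smul_set_subset_mul hl), ← setLIntegral_const]
      refine setLIntegral_mono hM ?_
      rintro _ ⟨u, hu, rfl⟩
      exact hFM l u hu
    · rw [Set.indicator_of_notMem hl, zero_mul]
      exact zero_le
  have hcount (y : G) : ∑' l : Λ, ((l : G) • U).indicator M y ≤ N * M y := by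
    have hind (l : Λ) : ((l : G) • U).indicator M y = (y • U).indicator 1 (l : G) * M y := by
      rw [← indicator_smul_inv_one, hU.inv_eq]
      by_cases hy : y ∈ (l : G) • U <;> simp [hy]
    simp only [hind, ENNReal.tsum_mul_right, tsum_indicator_one]
    gcongr
    exact_mod_cast h y
  rw [ENNReal.mul_comm_div, mul_div_assoc', ENNReal.le_div_iff_mul_le
    (Or.inl (hU.measure_ne_zero μ)) (Or.inl (hU.measure_ne_top μ))]
  calc (∑' l : Λ, S.indicator F l) * μ U = ∑' l : Λ, S.indicator F l * μ ((l : G) • U) := by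
        simp only [measure_smul, ENNReal.tsum_mul_right]
    _ ≤ ∑' l : Λ, ∫⁻ y in S * U, ((l : G) • U).indicator M y ∂μ :=
        ENNReal.tsum_le_tsum fun l => hterm l
    _ = ∫⁻ y in S * U, ∑' l : Λ, ((l : G) • U).indicator M y ∂μ :=
        (lintegral_tsum fun l : Λ => (hM.indicator (hlU l)).aemeasurable).symm
    _ ≤ ∫⁻ y in S * U, N * M y ∂μ := lintegral_mono fun y => hcount y
    _ = N * ∫⁻ y in S * U, M y ∂μ := lintegral_const_mul _ hM

theorem encard_inter_le (h : IsSeparated Λ U N) (hU : IsUnitWindow U) (μ : Measure G)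
    [μ.IsHaarMeasure] (S : Set G) : ((Λ ∩ S).encard : ℝ≥0∞) ≤ N / μ U * μ (S * U) := by
  have hle := h.tsum_indicator_le hU μ S (F := 1) (M := fun _ => 1) measurable_const
    fun _ _ _ => le_rfl
  rwa [tsum_indicator_one, setLIntegral_const, one_mul] at hle

end IsSeparated

end Separated

section LocalMaximal

variable {G : Type*} [Group G]

theorem localMaximal_mono {U V : Set G} (h : U ⊆ V) (F : G → ℂ) (x : G) :
    localMaximal U F x ≤ localMaximal V F x := biSup_mono h

theorem enorm_le_localMaximal {U : Set G} (hU : U⁻¹ = U) (F : G → ℂ) (x : G) {u : G}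
    (hu : u ∈ U) : ‖F x‖ₑ ≤ localMaximal U F (x * u) := by
  have h := le_iSup₂ (f := fun z (_ : z ∈ U) => ‖F (x * u * z)‖ₑ) u⁻¹ (hU ▸ Set.inv_mem_inv.2 hu)
  rwa [mul_inv_cancel_right] at h

variable [TopologicalSpace G] [IsTopologicalGroup G] [MeasurableSpace G]

theorem measurable_localMaximal [BorelSpace G] {F : G → ℂ} (hF : Continuous fun x => ‖F x‖)
    (U : Set G) : Measurable (localMaximal U F) := by
  have hF' : Continuous fun x => ‖F x‖ₑ := by
    simp only [← ofReal_norm]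
    exact ENNReal.continuous_ofReal.comp hF
  exact (lowerSemicontinuous_biSup fun z _ =>
    (hF'.comp (continuous_mul_const z)).lowerSemicontinuous).measurable

theorem ProjectiveRep.exists_isUnitWindow_of_mem_localized [LocallyCompactSpace G] {H : Type*}
    [NormedAddCommGroup H] [InnerProductSpace ℂ H] {π : ProjectiveRep G H} {μ : Measure G} {g : H}
    (hg : g ∈ π.localized μ) {V : Set G} (hV : V ∈ 𝓝 (1 : G)) :
    ∃ U ⊆ V, IsUnitWindow U ∧ ∫⁻ x, localMaximal U (π.coeff g g) x ^ 2 ∂μ ≠ ∞ := by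
  obtain ⟨Q, hQ, -, -, hint⟩ := hg
  obtain ⟨U, hU, hwin⟩ := exists_isUnitWindow_subset (inter_mem hV hQ)
  refine ⟨U, hU.trans Set.inter_subset_left, hwin, ne_top_of_le_ne_top hint.ne
    (lintegral_mono fun x => ?_)⟩
  gcongr
  exact localMaximal_mono (hU.trans Set.inter_subset_right) _ x

end LocalMaximal

theorem HasBesselBound.exists_isSeparated {G H : Type*} [Group G] [TopologicalSpace G]
    [IsTopologicalGroup G] [LocallyCompactSpace G] [SecondCountableTopology G] [MeasurableSpace G]
    [BorelSpace G] [NormedAddCommGroup H] [InnerProductSpace ℂ H]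
    [TopologicalSpace.SeparableSpace H] {π : ProjectiveRep G H} (μ : Measure G) [μ.IsHaarMeasure]
    {Λ : Set G} {g : H} (hg : g ≠ 0) {B : ℝ≥0} (h : HasBesselBound (fun l : Λ => π.op l g) B) :
    ∃ V ∈ 𝓝 (1 : G), ∃ N, IsSeparated Λ V N := by
  have : 0 < ‖g‖ := norm_pos_iff.2 hg
  let c : ℝ≥0∞ := ENNReal.ofReal (‖g‖ ^ 2 / 2)
  have hc : c ^ 2 ≠ 0 := pow_ne_zero 2 (ENNReal.ofReal_pos.2 (by positivity)).ne'
  have htop : (B : ℝ≥0∞) * ‖g‖ₑ ^ 2 ≠ ∞ :=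
    ENNReal.mul_ne_top ENNReal.coe_ne_top (ENNReal.pow_ne_top enorm_ne_top)
  refine ⟨{u | ‖g‖ ^ 2 / 2 < ‖π.coeff g g u‖},
    (π.tendsto_norm_coeff_self_one μ g).eventually_const_lt (half_lt_self (by positivity)), ?_⟩
  obtain ⟨N, hN⟩ := ENNReal.exists_nat_gt (ENNReal.div_ne_top htop hc)
  refine ⟨N, fun x => ?_⟩
  have hsum := h (π.op x g)
  rw [LinearIsometryEquiv.enorm_map] at hsum
  obtain ⟨hfin, hcard⟩ := ENNReal.finset_card_const_le_le_of_tsum_le htop hsum hc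
  have hsub : Λ ∩ x • {u | ‖g‖ ^ 2 / 2 < ‖π.coeff g g u‖} ⊆
      Subtype.val '' {l : Λ | c ^ 2 ≤ ‖inner ℂ (π.op l g) (π.op x g)‖ₑ ^ 2} := by
    rintro _ ⟨hl, u, hu, rfl⟩
    refine ⟨⟨_, hl⟩, ?_, rfl⟩
    have hnorm : ‖inner ℂ (π.op (x • u) g) (π.op x g)‖ = ‖π.coeff g g u‖ := by
      have hshift := π.norm_coeff_op g g x (x • u)
      rwa [smul_eq_mul, inv_mul_cancel_left] at hshift
    rw [Set.mem_ofPred_eq, ← ofReal_norm, hnorm]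
    exact pow_le_pow_left' (ENNReal.ofReal_le_ofReal (Set.mem_ofPred_eq ▸ hu).le) 2
  calc (Λ ∩ x • {u | ‖g‖ ^ 2 / 2 < ‖π.coeff g g u‖}).encard
      ≤ {l : Λ | c ^ 2 ≤ ‖inner ℂ (π.op l g) (π.op x g)‖ₑ ^ 2}.encard :=
        (Set.encard_le_encard hsub).trans (Set.encard_image_le _ _)
    _ = hfin.toFinset.card := hfin.encard_eq_coe_toFinset_card
    _ ≤ N := by exact_mod_cast (hcard.trans_lt hN).le

theorem mul_le_inv_mul_sq_add_mul_sq (u v : ℝ≥0∞) {t : ℝ≥0} (ht : t ≠ 0) :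
    u * v ≤ (t : ℝ≥0∞)⁻¹ * u ^ 2 + t * v ^ 2 := by
  have ht' : (t : ℝ≥0∞)⁻¹ * t = 1 :=
    ENNReal.inv_mul_cancel (ENNReal.coe_ne_zero.2 ht) ENNReal.coe_ne_top
  rcases le_total u (t * v) with h | h
  · calc u * v ≤ t * v * v := by gcongr
      _ = t * v ^ 2 := by ring
      _ ≤ _ := le_add_self
  · calc u * v = (t : ℝ≥0∞)⁻¹ * (u * (t * v)) := by
          rw [mul_left_comm u, ← mul_assoc, ht', one_mul]
      _ ≤ (t : ℝ≥0∞)⁻¹ * (u * u) := by gcongr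
      _ = (t : ℝ≥0∞)⁻¹ * u ^ 2 := by rw [sq]
      _ ≤ _ := le_self_add

theorem exists_isCompact_setLIntegral_compl_lt {X : Type*} [TopologicalSpace X] [T2Space X]
    [LocallyCompactSpace X] [SecondCountableTopology X] [MeasurableSpace X] [BorelSpace X]
    (μ : Measure X) {M : X → ℝ≥0∞} (hM : ∫⁻ x, M x ∂μ ≠ ∞) {ε : ℝ≥0∞} (hε : ε ≠ 0) :
    ∃ L : Set X, IsCompact L ∧ ∫⁻ x in Lᶜ, M x ∂μ < ε := by
  have := isFiniteMeasure_withDensity hM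
  obtain ⟨L, -, hL, hlt⟩ :=
    MeasurableSet.univ.exists_isCompact_sdiff_lt (measure_ne_top (μ.withDensity M) _) hε
  refine ⟨L, hL, ?_⟩
  rwa [← Set.compl_eq_univ_sdiff, withDensity_apply _ hL.measurableSet.compl] at hlt

theorem setLIntegral_smul_comp_inv_mul {G : Type*} [Group G] [MeasurableSpace G]
    [MeasurableMul G] (μ : Measure G) [μ.IsMulLeftInvariant] (M : G → ℝ≥0∞) (x : G) (A : Set G) :
    ∫⁻ y in x • A, M (x⁻¹ * y) ∂μ = ∫⁻ y in A, M y ∂μ := by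
  rw [← (measurePreserving_mul_left μ x⁻¹).setLIntegral_comp_preimage_emb
    (measurableEmbedding_mulLeft _) M A]
  simp only [← smul_eq_mul, Set.preimage_smul, inv_inv]

theorem setLIntegral_le_add_of_inter_subset {α : Type*} [MeasurableSpace α] (μ : Measure α)
    (F : α → ℝ≥0∞) {A B C D : Set α} (hB : MeasurableSet B) (h₁ : A ∩ B ⊆ C) (h₂ : A \ B ⊆ D) :
    ∫⁻ x in A, F x ∂μ ≤ ∫⁻ x in C, F x ∂μ + ∫⁻ x in D, F x ∂μ := by
  rw [← lintegral_inter_add_sdiff F A hB]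
  exact add_le_add (lintegral_mono_set h₁) (lintegral_mono_set h₂)

theorem mul_subset_union_boundary {G : Type*} [Group G] {K L U : Set G} (h : 1 ∈ L)
    (hU : U ⊆ L) : K * U ⊆ K ∪ (K * L ∩ (Kᶜ * L)) := by
  rintro _ ⟨k, hk, u, hu, rfl⟩
  by_cases hku : k * u ∈ K
  · exact Or.inl hku
  · exact Or.inr ⟨Set.mul_mem_mul hk (hU hu), _, hku, 1, h, mul_one _⟩

theorem IsUnitWindow.exists_isCompact_setLIntegral_compl_mul_le {G : Type*} [Group G]
    [TopologicalSpace G] [IsTopologicalGroup G] [T2Space G] [LocallyCompactSpace G]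
    [SecondCountableTopology G] [MeasurableSpace G] [BorelSpace G] {U : Set G}
    (hU : IsUnitWindow U) (μ : Measure G) {M : G → ℝ≥0∞} (hM : ∫⁻ x, M x ∂μ ≠ ∞) {ε : ℝ≥0∞}
    (hε : ε ≠ 0) :
    ∃ L, IsCompact L ∧ U ⊆ L ∧ L⁻¹ = L ∧ ∫⁻ y in Lᶜ * U, M y ∂μ ≤ ε := by
  obtain ⟨S, hS, hSε⟩ := exists_isCompact_setLIntegral_compl_lt μ hM hε
  have hT : IsCompact (S * closure U ∪ closure U) :=
    (hS.mul hU.isCompact_closure).union hU.isCompact_closure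
  refine ⟨_ ∪ (S * closure U ∪ closure U)⁻¹, hT.union hT.inv,
    fun u hu => Or.inl (Or.inr (subset_closure hu)), ?_, (lintegral_mono_set ?_).trans hSε.le⟩
  · rw [Set.union_inv, inv_inv, Set.union_comm]
  · rintro _ ⟨c, hc, u, hu, rfl⟩ hmem
    have hu' : u⁻¹ ∈ U := hU.inv_eq ▸ Set.inv_mem_inv.2 hu
    exact hc (Or.inl (Or.inl ⟨c * u, hmem, u⁻¹, subset_closure hu', mul_inv_cancel_right _ _⟩))

namespace ProjectiveRep

variable {G H : Type*} [Group G] [MeasurableSpace G] [NormedAddCommGroup H]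
  [InnerProductSpace ℂ H] (π : ProjectiveRep G H)

theorem IsFormalDegree.integral_norm_coeff_sq {π : ProjectiveRep G H} {μ : Measure G} {d : ℝ}
    (hd : π.IsFormalDegree μ d) (g f : H) :
    ∫ x, ‖π.coeff g f x‖ ^ 2 ∂μ = d⁻¹ * ‖f‖ ^ 2 * ‖g‖ ^ 2 := by
  have heq := (hd.2 f f g g).2
  simp only [RCLike.mul_conj, inner_self_eq_norm_sq_to_K, map_pow,
    RCLike.ofReal_eq_complex_ofReal, Complex.conj_ofReal] at heq
  exact_mod_cast heq

theorem IsFormalDegree.lintegral_enorm_coeff_sq {π : ProjectiveRep G H} {μ : Measure G} {d : ℝ}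
    (hd : π.IsFormalDegree μ d) (g f : H) :
    ∫⁻ x, ‖π.coeff g f x‖ₑ ^ 2 ∂μ = ENNReal.ofReal d⁻¹ * ‖f‖ₑ ^ 2 * ‖g‖ₑ ^ 2 := by
  have hint : Integrable (fun x => π.coeff g f x * (starRingEnd ℂ) (π.coeff g f x)) μ :=
    (hd.2 f f g g).1
  have hd' : 0 ≤ d⁻¹ := inv_nonneg.2 hd.1.le
  have h := ofReal_integral_norm_eq_lintegral_enorm hint
  simp only [norm_mul, enorm_mul, RCLike.norm_conj, RCLike.enorm_conj, ← sq] at h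
  rw [← h, hd.integral_norm_coeff_sq, ENNReal.ofReal_mul (by positivity), ENNReal.ofReal_mul hd',
    ENNReal.ofReal_pow (norm_nonneg _), ENNReal.ofReal_pow (norm_nonneg _), ofReal_norm,
    ofReal_norm]

theorem enorm_coeff_op (g f : H) (y x : G) :
    ‖π.coeff g (π.op y f) x‖ₑ = ‖π.coeff g f (y⁻¹ * x)‖ₑ := by
  rw [← ofReal_norm, norm_coeff_op, ofReal_norm]

theorem enorm_coeff_op_self (g : H) (y x : G) :
    ‖π.coeff g (π.op y g) x‖ₑ = ‖π.coeff g g (x⁻¹ * y)‖ₑ := by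
  rw [enorm_coeff_op, ← ofReal_norm, ← norm_coeff_inv, ofReal_norm, mul_inv_rev, inv_inv]

end ProjectiveRep

theorem HasBesselBound.tsum_enorm_coeff_sq_le {G H ι : Type*} [Group G] [MeasurableSpace G]
    [NormedAddCommGroup H] [InnerProductSpace ℂ H] {e : ι → H} {B : ℝ≥0} (h : HasBesselBound e B)
    (π : ProjectiveRep G H) (g : H) (x : G) :
    ∑' i, ‖π.coeff g (e i) x‖ₑ ^ 2 ≤ B * ‖g‖ₑ ^ 2 := by
  have hx := h (π.op x g)
  rw [LinearIsometryEquiv.enorm_map] at hx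
  simpa only [ProjectiveRep.coeff, ← ofReal_norm, norm_inner_symm] using hx

namespace ProjectiveRep

variable {G H : Type*} [Group G] [MeasurableSpace G] [NormedAddCommGroup H]
  [InnerProductSpace ℂ H] (π : ProjectiveRep G H) {Λ : Set G} (g : H) (h : Λ → H)

/-- The term of index `l` of the kernel `∑ₗ ⟨π(l) g, π(x) g⟩ ⟨π(x) g, h l⟩`, as a function of `x`.
When `h` is dual to `π(Λ) g`, the kernel is the squared norm of the projection of `π(x) g` on the
span of `π(Λ) g`. -/
noncomputable def kernelTerm (l : Λ) (x : G) : ℂ :=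
  π.coeff g (π.op l g) x * (starRingEnd ℂ) (π.coeff g (h l) x)

theorem measurable_kernelTerm (l : Λ) : Measurable (π.kernelTerm g h l) :=
  (π.stronglyMeasurable_coeff _ _).measurable.mul
    (continuous_star.comp_stronglyMeasurable (π.stronglyMeasurable_coeff g (h l))).measurable

theorem enorm_kernelTerm (l : Λ) (x : G) : ‖π.kernelTerm g h l x‖ₑ =
    ‖π.coeff g (π.op l g) x‖ₑ * ‖π.coeff g (h l) x‖ₑ := by
  rw [kernelTerm, enorm_mul, RCLike.enorm_conj]

theorem enorm_kernelTerm_le {t : ℝ≥0} (ht : t ≠ 0) (l : Λ) (x : G) : ‖π.kernelTerm g h l x‖ₑ ≤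
    (t : ℝ≥0∞)⁻¹ * ‖π.coeff g (π.op l g) x‖ₑ ^ 2 + t * ‖π.coeff g (h l) x‖ₑ ^ 2 := by
  rw [enorm_kernelTerm]
  exact mul_le_inv_mul_sq_add_mul_sq _ _ ht

variable {h}

theorem tsum_enorm_kernelTerm_le {B B' : ℝ≥0} (hB : HasBesselBound (fun l : Λ => π.op l g) B)
    (hB' : HasBesselBound h B') (x : G) :
    ∑' l, ‖π.kernelTerm g h l x‖ₑ ≤ (B + B') * ‖g‖ₑ ^ 2 := by
  calc ∑' l, ‖π.kernelTerm g h l x‖ₑ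
      ≤ ∑' l : Λ, (‖π.coeff g (π.op l g) x‖ₑ ^ 2 + ‖π.coeff g (h l) x‖ₑ ^ 2) :=
        ENNReal.tsum_le_tsum fun l => by simpa using π.enorm_kernelTerm_le g h one_ne_zero l x
    _ ≤ B * ‖g‖ₑ ^ 2 + B' * ‖g‖ₑ ^ 2 := by
        rw [ENNReal.tsum_add]
        exact add_le_add (hB.tsum_enorm_coeff_sq_le π g x) (hB'.tsum_enorm_coeff_sq_le π g x)
    _ = (B + B') * ‖g‖ₑ ^ 2 := (add_mul _ _ _).symm

theorem tsum_setLIntegral_enorm_kernelTerm_le [Countable Λ] (μ : Measure G) {B B' : ℝ≥0}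
    (hB : HasBesselBound (fun l : Λ => π.op l g) B) (hB' : HasBesselBound h B') (S : Set G) :
    ∑' l, ∫⁻ x in S, ‖π.kernelTerm g h l x‖ₑ ∂μ ≤ (B + B') * ‖g‖ₑ ^ 2 * μ S := by
  rw [← lintegral_tsum fun l => (π.measurable_kernelTerm g h l).enorm.aemeasurable,
    ← setLIntegral_const]
  exact lintegral_mono fun x => π.tsum_enorm_kernelTerm_le g hB hB' x

end ProjectiveRep

section Localization

variable {G H : Type*} [Group G] [TopologicalSpace G] [IsTopologicalGroup G] [MeasurableSpace G]
  [BorelSpace G] [NormedAddCommGroup H] [InnerProductSpace ℂ H] {π : ProjectiveRep G H}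
  {μ : Measure G} [μ.IsHaarMeasure] {Λ U L : Set G} {g : H} {h : Λ → H} {B' t : ℝ≥0}

theorem tsum_indicator_enorm_coeff_op_sq_le [LocallyCompactSpace G] [SecondCountableTopology G]
    [TopologicalSpace.SeparableSpace H] {N : ℕ} (hs : IsSeparated Λ U N) (hU : IsUnitWindow U)
    (x : G) (A : Set G) :
    ∑' l : Λ, (x • A).indicator (fun l => ‖π.coeff g (π.op l g) x‖ₑ ^ 2) (l : G) ≤
      N / μ U * ∫⁻ y in A * U, localMaximal U (π.coeff g g) y ^ 2 ∂μ := by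
  have hM : Measurable fun y => localMaximal U (π.coeff g g) y ^ 2 :=
    (measurable_localMaximal (π.continuous_norm_coeff μ g g) U).pow_const 2
  rw [← setLIntegral_smul_comp_inv_mul μ (fun y => localMaximal U (π.coeff g g) y ^ 2) x,
    ← smul_mul_assoc]
  refine hs.tsum_indicator_le hU μ _ (hM.comp (measurable_const_mul x⁻¹)) fun l u hu => ?_
  rw [enorm_coeff_op_self, ← mul_assoc]
  gcongr
  exact enorm_le_localMaximal hU.inv_eq _ _ hu

theorem tsum_indicator_enorm_kernelTerm_le [LocallyCompactSpace G] [SecondCountableTopology G]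
    [TopologicalSpace.SeparableSpace H] {N : ℕ} (hs : IsSeparated Λ U N) (hU : IsUnitWindow U)
    (hB' : HasBesselBound h B') (ht : t ≠ 0)
    (hL : ∫⁻ y in Lᶜ * U, localMaximal U (π.coeff g g) y ^ 2 ∂μ ≤ t ^ 2) (x : G) :
    ∑' l : Λ, (x • Lᶜ).indicator 1 (l : G) * ‖π.kernelTerm g h l x‖ₑ ≤
      t * (N / μ U + B' * ‖g‖ₑ ^ 2) := by
  have hterm (l : Λ) : (x • Lᶜ).indicator 1 (l : G) * ‖π.kernelTerm g h l x‖ₑ ≤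
      (t : ℝ≥0∞)⁻¹ * (x • Lᶜ).indicator (fun l => ‖π.coeff g (π.op l g) x‖ₑ ^ 2) (l : G) +
        t * ‖π.coeff g (h l) x‖ₑ ^ 2 := by
    by_cases hl : (l : G) ∈ x • Lᶜ
    · simpa only [Set.indicator_of_mem hl, Pi.one_apply, one_mul] using
        π.enorm_kernelTerm_le g h ht l x
    · simp only [Set.indicator_of_notMem hl, zero_mul, zero_le]
  calc ∑' l : Λ, (x • Lᶜ).indicator 1 (l : G) * ‖π.kernelTerm g h l x‖ₑ
      ≤ (t : ℝ≥0∞)⁻¹ * ∑' l : Λ, (x • Lᶜ).indicator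
          (fun l => ‖π.coeff g (π.op l g) x‖ₑ ^ 2) (l : G) +
        t * ∑' l, ‖π.coeff g (h l) x‖ₑ ^ 2 := by
        rw [← ENNReal.tsum_mul_left, ← ENNReal.tsum_mul_left, ← ENNReal.tsum_add]
        exact ENNReal.tsum_le_tsum hterm
    _ ≤ (t : ℝ≥0∞)⁻¹ * (N / μ U * t ^ 2) + t * (B' * ‖g‖ₑ ^ 2) := by
        gcongr
        · exact (tsum_indicator_enorm_coeff_op_sq_le hs hU x Lᶜ).trans (by gcongr)
        · exact hB'.tsum_enorm_coeff_sq_le π g x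
    _ = t * (N / μ U + B' * ‖g‖ₑ ^ 2) := by
        rw [mul_left_comm, sq, ← mul_assoc _ (t : ℝ≥0∞), ENNReal.inv_mul_cancel
          (ENNReal.coe_ne_zero.2 ht) ENNReal.coe_ne_top, one_mul, mul_comm (N / μ U), mul_add]

theorem setLIntegral_enorm_kernelTerm_le (hU : IsUnitWindow U) (hB' : HasBesselBound h B')
    {d : ℝ} (hd : π.IsFormalDegree μ d) (ht : t ≠ 0)
    (hL : ∫⁻ y in Lᶜ * U, localMaximal U (π.coeff g g) y ^ 2 ∂μ ≤ t ^ 2) (l : Λ) :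
    ∫⁻ x in (l : G) • Lᶜ, ‖π.kernelTerm g h l x‖ₑ ∂μ ≤
      t * (1 + ENNReal.ofReal d⁻¹ * B' * ‖g‖ₑ ^ 2) := by
  have hm (f : H) : Measurable fun x => ‖π.coeff g f x‖ₑ ^ 2 :=
    (π.stronglyMeasurable_coeff g f).measurable.enorm.pow_const 2
  have htail : ∫⁻ x in (l : G) • Lᶜ, ‖π.coeff g (π.op l g) x‖ₑ ^ 2 ∂μ ≤ t ^ 2 := by
    simp only [enorm_coeff_op]
    rw [setLIntegral_smul_comp_inv_mul μ (fun y => ‖π.coeff g g y‖ₑ ^ 2)]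
    refine (lintegral_mono_set (hU.subset_mul _)).trans ((lintegral_mono fun y => ?_).trans hL)
    gcongr
    simpa only [mul_one] using enorm_le_localMaximal hU.inv_eq (π.coeff g g) y hU.one_mem
  calc ∫⁻ x in (l : G) • Lᶜ, ‖π.kernelTerm g h l x‖ₑ ∂μ
      ≤ ∫⁻ x in (l : G) • Lᶜ, ((t : ℝ≥0∞)⁻¹ * ‖π.coeff g (π.op l g) x‖ₑ ^ 2 +
          t * ‖π.coeff g (h l) x‖ₑ ^ 2) ∂μ :=
        lintegral_mono fun x => π.enorm_kernelTerm_le g h ht l x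
    _ = (t : ℝ≥0∞)⁻¹ * ∫⁻ x in (l : G) • Lᶜ, ‖π.coeff g (π.op l g) x‖ₑ ^ 2 ∂μ +
          t * ∫⁻ x in (l : G) • Lᶜ, ‖π.coeff g (h l) x‖ₑ ^ 2 ∂μ := by
        rw [lintegral_add_left ((hm _).const_mul _), lintegral_const_mul _ (hm _),
          lintegral_const_mul _ (hm _)]
    _ ≤ (t : ℝ≥0∞)⁻¹ * t ^ 2 + t * (ENNReal.ofReal d⁻¹ * B' * ‖g‖ₑ ^ 2) := by
        gcongr
        refine (setLIntegral_le_lintegral _ _).trans ?_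
        rw [hd.lintegral_enorm_coeff_sq]
        gcongr
        exact hB'.enorm_sq_le l
    _ = t * (1 + ENNReal.ofReal d⁻¹ * B' * ‖g‖ₑ ^ 2) := by
        rw [sq, ← mul_assoc _ (t : ℝ≥0∞), ENNReal.inv_mul_cancel (ENNReal.coe_ne_zero.2 ht)
          ENNReal.coe_ne_top, one_mul, mul_add, mul_one]

end Localization

/-- The error made when the terms of the kernel indexed by `K` are integrated over the whole group
instead of `K`, and the terms indexed outside `K` are dropped. -/
noncomputable def truncationError {G H : Type*} [Group G] [MeasurableSpace G]
    [NormedAddCommGroup H] [InnerProductSpace ℂ H] (π : ProjectiveRep G H) (μ : Measure G)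
    {Λ : Set G} (g : H) (h : Λ → H) (K : Set G) (l : Λ) : ℝ≥0∞ :=
  K.indicator 1 (l : G) * ∫⁻ x in Kᶜ, ‖π.kernelTerm g h l x‖ₑ ∂μ +
    Kᶜ.indicator 1 (l : G) * ∫⁻ x in K, ‖π.kernelTerm g h l x‖ₑ ∂μ

section TruncationError

variable {G H : Type*} [Group G] [MeasurableSpace G] [NormedAddCommGroup H]
  [InnerProductSpace ℂ H] {π : ProjectiveRep G H} {μ : Measure G} {Λ : Set G} {g : H} {h : Λ → H}
  {K : Set G} {l : Λ}

theorem truncationError_of_mem (hl : (l : G) ∈ K) :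
    truncationError π μ g h K l = ∫⁻ x in Kᶜ, ‖π.kernelTerm g h l x‖ₑ ∂μ := by
  simp [truncationError, hl]

theorem truncationError_of_notMem (hl : (l : G) ∉ K) :
    truncationError π μ g h K l = ∫⁻ x in K, ‖π.kernelTerm g h l x‖ₑ ∂μ := by
  simp [truncationError, hl]

theorem enorm_setIntegral_sub_indicator_le_truncationError (hK : MeasurableSet K)
    (hint : Integrable (π.kernelTerm g h l) μ) :
    ‖∫ x in K, π.kernelTerm g h l x ∂μ -
      K.indicator (fun _ => ∫ x, π.kernelTerm g h l x ∂μ) (l : G)‖ₑ ≤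
      truncationError π μ g h K l := by
  by_cases hl : (l : G) ∈ K
  · rw [Set.indicator_of_mem hl, truncationError_of_mem hl, ← integral_add_compl hK hint,
      sub_add_cancel_left, enorm_neg]
    exact enorm_integral_le_lintegral_enorm _
  · rw [Set.indicator_of_notMem hl, truncationError_of_notMem hl, sub_zero]
    exact enorm_integral_le_lintegral_enorm _

end TruncationError

section Estimate

variable {G H : Type*} [Group G] [TopologicalSpace G] [IsTopologicalGroup G] [MeasurableSpace G]
  [BorelSpace G] [NormedAddCommGroup H] [InnerProductSpace ℂ H] {π : ProjectiveRep G H}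
  {μ : Measure G} {Λ : Set G} {g : H} {h : Λ → H}

theorem truncationError_le {K L : Set G} (hL : MeasurableSet L) (h₁ : (1 : G) ∈ L) (l : Λ) :
    truncationError π μ g h K l ≤ ∫⁻ x in K * L ∩ (Kᶜ * L), ‖π.kernelTerm g h l x‖ₑ ∂μ +
      (K.indicator 1 (l : G) * ∫⁻ x in (l : G) • Lᶜ, ‖π.kernelTerm g h l x‖ₑ ∂μ +
        ∫⁻ x in K ∩ (l : G) • Lᶜ, ‖π.kernelTerm g h l x‖ₑ ∂μ) := by
  have hlL : MeasurableSet ((l : G) • L) := hL.const_smul _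
  rw [Set.smul_set_compl]
  by_cases hl : (l : G) ∈ K
  · rw [truncationError_of_mem hl, Set.indicator_of_mem hl, Pi.one_apply, one_mul]
    refine (setLIntegral_le_add_of_inter_subset μ _ hlL ?_ fun x hx => hx.2).trans
      (add_le_add_right le_self_add _)
    rintro x ⟨hx, y, hy, rfl⟩
    exact ⟨Set.mul_mem_mul hl hy, _, hx, 1, h₁, mul_one _⟩
  · rw [truncationError_of_notMem hl, Set.indicator_of_notMem hl, zero_mul, zero_add]
    refine setLIntegral_le_add_of_inter_subset μ _ hlL ?_ fun x hx => hx
    rintro x ⟨hx, y, hy, rfl⟩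
    exact ⟨⟨_, hx, 1, h₁, mul_one _⟩, Set.mul_mem_mul hl hy⟩

variable [SecondCountableTopology G] [μ.IsHaarMeasure] {U L : Set G} {N : ℕ} {B B' t : ℝ≥0}
  {d : ℝ}

theorem tsum_indicator_mul_setLIntegral_enorm_kernelTerm_le (hs : IsSeparated Λ U N)
    (hU : IsUnitWindow U) (hUL : U ⊆ L) (hB' : HasBesselBound h B') (hd : π.IsFormalDegree μ d)
    (ht : t ≠ 0) (hL : ∫⁻ y in Lᶜ * U, localMaximal U (π.coeff g g) y ^ 2 ∂μ ≤ t ^ 2)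
    (K : Set G) :
    ∑' l : Λ, K.indicator 1 (l : G) * ∫⁻ x in (l : G) • Lᶜ, ‖π.kernelTerm g h l x‖ₑ ∂μ ≤
      N / μ U * (μ K + μ (K * L ∩ (Kᶜ * L))) *
        (t * (1 + ENNReal.ofReal d⁻¹ * B' * ‖g‖ₑ ^ 2)) := by
  calc ∑' l : Λ, K.indicator 1 (l : G) * ∫⁻ x in (l : G) • Lᶜ, ‖π.kernelTerm g h l x‖ₑ ∂μ
      ≤ ∑' l : Λ, K.indicator 1 (l : G) * (t * (1 + ENNReal.ofReal d⁻¹ * B' * ‖g‖ₑ ^ 2)) := by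
        gcongr with l
        exact setLIntegral_enorm_kernelTerm_le hU hB' hd ht hL l
    _ = ((Λ ∩ K).encard : ℝ≥0∞) * (t * (1 + ENNReal.ofReal d⁻¹ * B' * ‖g‖ₑ ^ 2)) := by
        rw [ENNReal.tsum_mul_right, tsum_indicator_one]
    _ ≤ N / μ U * (μ K + μ (K * L ∩ (Kᶜ * L))) *
        (t * (1 + ENNReal.ofReal d⁻¹ * B' * ‖g‖ₑ ^ 2)) := by
        gcongr
        refine (hs.encard_inter_le hU μ K).trans ?_
        gcongr
        exact (measure_mono (mul_subset_union_boundary (hUL hU.one_mem) hUL)).trans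
          (measure_union_le _ _)

theorem tsum_setLIntegral_inter_smul_compl_le [LocallyCompactSpace G]
    [TopologicalSpace.SeparableSpace H] (hs : IsSeparated Λ U N) (hU : IsUnitWindow U)
    (hLm : MeasurableSet L) (hLinv : L⁻¹ = L) (hB' : HasBesselBound h B') (ht : t ≠ 0)
    (hL : ∫⁻ y in Lᶜ * U, localMaximal U (π.coeff g g) y ^ 2 ∂μ ≤ t ^ 2) (K : Set G) :
    ∑' l : Λ, ∫⁻ x in K ∩ (l : G) • Lᶜ, ‖π.kernelTerm g h l x‖ₑ ∂μ ≤
      t * (N / μ U + B' * ‖g‖ₑ ^ 2) * μ K := by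
  have := (hs.countable hU.mem_nhds).to_subtype
  have hlL (l : Λ) : MeasurableSet ((l : G) • Lᶜ) := hLm.compl.const_smul _
  have hmeas (l : Λ) := (π.measurable_kernelTerm g h l).enorm
  have hind (l : Λ) (x : G) : ((l : G) • Lᶜ).indicator (fun x => ‖π.kernelTerm g h l x‖ₑ) x =
      (x • Lᶜ).indicator 1 (l : G) * ‖π.kernelTerm g h l x‖ₑ := by
    rw [← indicator_smul_inv_one, Set.compl_inv, hLinv]
    by_cases hx : x ∈ (l : G) • Lᶜ <;> simp [hx]
  calc ∑' l : Λ, ∫⁻ x in K ∩ (l : G) • Lᶜ, ‖π.kernelTerm g h l x‖ₑ ∂μ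
      = ∫⁻ x in K, ∑' l : Λ, (x • Lᶜ).indicator 1 (l : G) * ‖π.kernelTerm g h l x‖ₑ ∂μ := by
        simp only [← hind]
        rw [lintegral_tsum fun l : Λ => ((hmeas l).indicator (hlL l)).aemeasurable]
        simp only [lintegral_indicator (hlL _), Measure.restrict_restrict (hlL _), Set.inter_comm K]
    _ ≤ ∫⁻ _ in K, t * (N / μ U + B' * ‖g‖ₑ ^ 2) ∂μ :=
        lintegral_mono fun x => tsum_indicator_enorm_kernelTerm_le hs hU hB' ht hL x
    _ = t * (N / μ U + B' * ‖g‖ₑ ^ 2) * μ K := setLIntegral_const _ _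

theorem exists_tsum_truncationError_le [T2Space G] [LocallyCompactSpace G]
    [TopologicalSpace.SeparableSpace H] (hs : IsSeparated Λ U N) (hU : IsUnitWindow U)
    (hM : ∫⁻ x, localMaximal U (π.coeff g g) x ^ 2 ∂μ ≠ ∞)
    (hB : HasBesselBound (fun l : Λ => π.op l g) B) (hB' : HasBesselBound h B')
    (hd : π.IsFormalDegree μ d) {ε : ℝ≥0∞} (hε : ε ≠ 0) :
    ∃ L, IsCompact L ∧ ∃ C ≠ ∞, ∀ K : Set G,
      ∑' l, truncationError π μ g h K l ≤ ε * μ K + C * μ (K * L ∩ (Kᶜ * L)) := by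
  have := (hs.countable hU.mem_nhds).to_subtype
  have hp : (N : ℝ≥0∞) / μ U ≠ ∞ :=
    ENNReal.div_ne_top (ENNReal.natCast_ne_top N) (hU.measure_ne_zero μ)
  let P : ℝ≥0∞ := 1 + ENNReal.ofReal d⁻¹ * B' * ‖g‖ₑ ^ 2
  let R : ℝ≥0∞ := N / μ U + B' * ‖g‖ₑ ^ 2
  have hP : P ≠ ∞ := by finiteness
  have hR : R ≠ ∞ := by finiteness
  obtain ⟨t, ht, htε⟩ :=
    ENNReal.exists_nnreal_pos_mul_lt (a := N / μ U * P + R) (by finiteness) hε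
  obtain ⟨L, hLc, hUL, hLinv, hL⟩ := hU.exists_isCompact_setLIntegral_compl_mul_le μ hM
    (ε := (t : ℝ≥0∞) ^ 2) (pow_ne_zero 2 (ENNReal.coe_ne_zero.2 ht.ne'))
  refine ⟨L, hLc, (B + B') * ‖g‖ₑ ^ 2 + N / μ U * (t * P), by finiteness, fun K => ?_⟩
  calc ∑' l, truncationError π μ g h K l
      ≤ (B + B') * ‖g‖ₑ ^ 2 * μ (K * L ∩ (Kᶜ * L)) +
          (N / μ U * (μ K + μ (K * L ∩ (Kᶜ * L))) * (t * P) + t * R * μ K) := by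
        refine (ENNReal.tsum_le_tsum fun l =>
          truncationError_le hLc.measurableSet (hUL hU.one_mem) l).trans ?_
        rw [ENNReal.tsum_add, ENNReal.tsum_add]
        gcongr
        · exact π.tsum_setLIntegral_enorm_kernelTerm_le g μ hB hB' _
        · exact tsum_indicator_mul_setLIntegral_enorm_kernelTerm_le hs hU hUL hB' hd ht.ne' hL K
        · exact tsum_setLIntegral_inter_smul_compl_le hs hU hLc.measurableSet hLinv hB' ht.ne' hL K
    _ = t * (N / μ U * P + R) * μ K +
          ((B + B') * ‖g‖ₑ ^ 2 + N / μ U * (t * P)) * μ (K * L ∩ (Kᶜ * L)) := by ring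
    _ ≤ ε * μ K + ((B + B') * ‖g‖ₑ ^ 2 + N / μ U * (t * P)) * μ (K * L ∩ (Kᶜ * L)) := by
        gcongr

end Estimate

section Dual

variable {H ι : Type*} [NormedAddCommGroup H] [InnerProductSpace ℂ H] {e h : ι → H}

theorem lp_norm_sq_eq_tsum (c : lp (fun _ : ι => ℂ) 2) : ‖c‖ ^ 2 = ∑' i, ‖c i‖ ^ 2 := by
  simpa using lp.norm_rpow_eq_tsum (by norm_num : 0 < (2 : ℝ≥0∞).toReal) c

theorem inner_lp_single_one [DecidableEq ι] (i : ι) (c : lp (fun _ : ι => ℂ) 2) :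
    inner ℂ (lp.single 2 i (1 : ℂ)) c = c i := by
  rw [lp.inner_single_left]
  simp

theorem hasBesselBound_of_apply_eq_inner (R : H →L[ℂ] lp (fun _ : ι => ℂ) 2)
    (hR : ∀ f i, R f i = inner ℂ (e i) f) : HasBesselBound e (‖R‖₊ ^ 2) := by
  intro f
  have hsum : Summable fun i => ‖R f i‖ ^ 2 := by
    simpa using (lp.memℓp (R f)).summable (by norm_num : 0 < (2 : ℝ≥0∞).toReal)
  calc ∑' i, ‖inner ℂ (e i) f‖ₑ ^ 2 = ∑' i, ENNReal.ofReal (‖R f i‖ ^ 2) := by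
        simp only [← hR, ENNReal.ofReal_pow (norm_nonneg _), ofReal_norm]
    _ = ‖R f‖ₑ ^ 2 := by
        rw [← ENNReal.ofReal_tsum_of_nonneg (fun i => by positivity) hsum, ← lp_norm_sq_eq_tsum,
          ENNReal.ofReal_pow (norm_nonneg _), ofReal_norm]
    _ ≤ (‖R‖ₑ * ‖f‖ₑ) ^ 2 := by
        gcongr
        exact R.le_opENorm f
    _ = ↑(‖R‖₊ ^ 2) * ‖f‖ₑ ^ 2 := by rw [mul_pow, ENNReal.coe_pow, enorm_eq_nnnorm R]

theorem tsum_inner_mul_inner_eq {R S : H →L[ℂ] lp (fun _ : ι => ℂ) 2}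
    (hR : ∀ f i, R f i = inner ℂ (e i) f) (hS : ∀ f i, S f i = inner ℂ (h i) f) (f : H) :
    ∑' i, inner ℂ f (e i) * inner ℂ (h i) f = inner ℂ (R f) (S f) := by
  rw [lp.inner_eq_tsum]
  refine tsum_congr fun i => ?_
  rw [RCLike.inner_apply', hR, hS, inner_conj_symm]

theorem exists_analysis_operator {B : ℝ} (hB : 0 ≤ B)
    (he : ∀ f, Summable (fun i => ‖inner ℂ (e i) f‖ ^ 2) ∧
      ∑' i, ‖inner ℂ (e i) f‖ ^ 2 ≤ B * ‖f‖ ^ 2) :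
    ∃ R : H →L[ℂ] lp (fun _ : ι => ℂ) 2, ∀ f i, R f i = inner ℂ (e i) f := by
  have hmem (f : H) : Memℓp (fun i => inner ℂ (e i) f) 2 := memℓp_gen (by simpa using (he f).1)
  let R : H →ₗ[ℂ] lp (fun _ : ι => ℂ) 2 :=
    { toFun := fun f => ⟨fun i => inner ℂ (e i) f, hmem f⟩
      map_add' := fun f f' => lp.ext (funext fun i => inner_add_right _ _ _)
      map_smul' := fun c f => lp.ext (funext fun i => inner_smul_right _ _ _) }
  refine ⟨R.mkContinuous (√B) fun f => le_of_sq_le_sq ?_ (by positivity), fun f i => rfl⟩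
  rw [mul_pow, Real.sq_sqrt hB]
  exact (lp_norm_sq_eq_tsum _).trans_le (he f).2

theorem exists_synthesis_operator {B : ℝ} (hB : 0 ≤ B)
    (he : ∀ c : lp (fun _ : ι => ℂ) 2, Summable (fun i => c i • e i) ∧
      ‖∑' i, c i • e i‖ ^ 2 ≤ B * ‖c‖ ^ 2) :
    ∃ T : lp (fun _ : ι => ℂ) 2 →L[ℂ] H, ∀ c, T c = ∑' i, c i • e i := by
  let T : lp (fun _ : ι => ℂ) 2 →ₗ[ℂ] H :=
    { toFun := fun c => ∑' i, c i • e i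
      map_add' := fun c c' => by
        rw [← (he c).1.tsum_add (he c').1]
        exact tsum_congr fun i => add_smul _ _ _
      map_smul' := fun a c => by
        rw [RingHom.id_apply, ← (he c).1.tsum_const_smul]
        exact tsum_congr fun i => mul_smul _ _ _ }
  refine ⟨T.mkContinuous (√B) fun c => le_of_sq_le_sq ?_ (by positivity), fun c => rfl⟩
  rw [mul_pow, Real.sq_sqrt hB]
  exact (he c).2

variable [CompleteSpace H]

-- The dual family consists of the images of the unit vectors under a left inverse `Y` of the
-- analysis operator `R` with `‖R ∘ Y‖ ≤ 1`, so the diagonal pairing is at most one.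
theorem IsFrame.exists_dual (he : IsFrame e) :
    ∃ (h : ι → H) (B B' : ℝ≥0), HasBesselBound e B ∧ HasBesselBound h B' ∧
      (∀ f, ∑' i, inner ℂ f (e i) * inner ℂ (h i) f = (‖f‖ : ℂ) ^ 2) ∧
      ∀ i, ‖inner ℂ (h i) (e i)‖ ≤ 1 := by
  classical
  obtain ⟨A, B, hA, hB, hAB⟩ := he
  obtain ⟨R, hR⟩ := exists_analysis_operator hB.le fun f => ⟨(hAB f).1, (hAB f).2.2⟩
  obtain ⟨Y, hY, hRY⟩ := exists_leftInverse_of_le_norm R hA fun f => by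
    simpa only [lp_norm_sq_eq_tsum, hR] using (hAB f).2.1
  have hS (f : H) (i : ι) : Y.adjoint f i = inner ℂ (Y (lp.single 2 i 1)) f := by
    rw [← inner_lp_single_one, ContinuousLinearMap.adjoint_inner_right]
  refine ⟨fun i => Y (lp.single 2 i 1), _, _, hasBesselBound_of_apply_eq_inner R hR,
    hasBesselBound_of_apply_eq_inner _ hS, fun f => ?_, fun i => ?_⟩
  · rw [tsum_inner_mul_inner_eq hR hS, ContinuousLinearMap.adjoint_inner_right, hY,
      inner_self_eq_norm_sq_to_K]
    rfl
  · rw [norm_inner_symm, ← hR]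
    refine (lp.norm_apply_le_norm two_ne_zero _ _).trans ((hRY _).trans_eq ?_)
    rw [lp.norm_single two_pos, norm_one]

theorem IsRieszSequence.exists_dual (he : IsRieszSequence e) :
    ∃ (h : ι → H) (B B' : ℝ≥0), HasBesselBound e B ∧ HasBesselBound h B' ∧
      (∀ f, ‖∑' i, inner ℂ f (e i) * inner ℂ (h i) f‖ ≤ ‖f‖ ^ 2) ∧
      ∀ i, inner ℂ (h i) (e i) = 1 := by
  classical
  obtain ⟨A, B, hA, hB, hAB⟩ := he
  obtain ⟨T, hT⟩ := exists_synthesis_operator hB.le fun c => ⟨(hAB c).1, (hAB c).2.2⟩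
  obtain ⟨Y, hY, hTY⟩ := exists_leftInverse_of_le_norm T hA fun c => by
    simpa only [hT] using (hAB c).2.1
  have hTe (i : ι) : T (lp.single 2 i 1) = e i := by
    rw [hT, tsum_eq_single i fun j hj => by rw [lp.single_apply_ne _ _ _ hj, zero_smul],
      lp.single_apply_self, one_smul]
  have hR (f : H) (i : ι) : T.adjoint f i = inner ℂ (e i) f := by
    rw [← inner_lp_single_one, ContinuousLinearMap.adjoint_inner_right, hTe]
  have hS (f : H) (i : ι) : Y f i = inner ℂ (Y.adjoint (lp.single 2 i 1)) f := by
    rw [ContinuousLinearMap.adjoint_inner_left, inner_lp_single_one]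
  refine ⟨fun i => Y.adjoint (lp.single 2 i 1), _, _, hasBesselBound_of_apply_eq_inner _ hR,
    hasBesselBound_of_apply_eq_inner Y hS, fun f => ?_, fun i => ?_⟩
  · rw [tsum_inner_mul_inner_eq hR hS, ContinuousLinearMap.adjoint_inner_left, sq]
    refine (norm_inner_le_norm _ _).trans ?_
    gcongr
    exact hTY f
  · rw [← hS, ← hTe, hY, lp.single_apply_self]

end Dual

section BeurlingDensity

variable {G : Type*} [Group G] [TopologicalSpace G] [IsTopologicalGroup G]
  [MeasurableSpace G] [BorelSpace G] {μ : Measure G} {Λ K M : Set G} {a : ℝ≥0∞}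

theorem setLIntegral_encard_inter_smul [T2Space G] (hΛ : Λ.Countable) (hM : IsCompact M)
    (A : Set G) :
    ∫⁻ y in A, ((Λ ∩ y • M).encard : ℝ≥0∞) ∂μ = ∑' l : Λ, μ ((l : G) • M⁻¹ ∩ A) := by
  have := hΛ.to_subtype
  have hlM (l : Λ) : MeasurableSet ((l : G) • M⁻¹) := (hM.inv.smul (l : G)).measurableSet
  have hind (l : Λ) (y : G) : (y • M).indicator (1 : G → ℝ≥0∞) l = ((l : G) • M⁻¹).indicator 1 y :=
    (indicator_smul_inv_one M _ _).symm
  simp only [← tsum_indicator_one, hind]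
  rw [lintegral_tsum fun l => (measurable_one.indicator (hlM l)).aemeasurable]
  refine tsum_congr fun l => ?_
  rw [lintegral_indicator_one (hlM l), Measure.restrict_apply (hlM l)]

variable [LocallyCompactSpace G] [SecondCountableTopology G] [μ.IsHaarMeasure]

theorem measure_smul_inv [μ.IsMulRightInvariant] (l : G) (M : Set G) : μ (l • M⁻¹) = μ M := by
  have := isInvInvariant_of_isMulRightInvariant μ
  rw [measure_smul, Measure.measure_inv]

section Averages

variable [T2Space G] [μ.IsMulRightInvariant]

theorem mul_measure_le_encard (hΛ : Λ.Countable) (hM : IsCompact M) (hM₀ : μ M ≠ 0)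
    (ha : ∀ y : G, a ≤ ((Λ ∩ y • M).encard : ℝ≥0∞) / μ M) (x : G) :
    a * μ K ≤ ((Λ ∩ x • (K * M)).encard : ℝ≥0∞) := by
  have hterm (l : Λ) :
      μ ((l : G) • M⁻¹ ∩ x • K) ≤ (x • (K * M)).indicator 1 (l : G) * μ M := by
    by_cases hl : (l : G) ∈ x • (K * M)
    · rw [Set.indicator_of_mem hl, Pi.one_apply, one_mul, ← measure_smul_inv (l : G) M]
      exact measure_mono Set.inter_subset_left
    · have hdisj : (l : G) • M⁻¹ ∩ x • K = ∅ := by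
        refine Set.eq_empty_of_forall_notMem ?_
        rintro y ⟨⟨m, hm, rfl⟩, hy⟩
        rw [← smul_mul_assoc] at hl
        exact hl ⟨_, hy, m⁻¹, hm, by simp⟩
      simp [hdisj]
  refine (ENNReal.mul_le_mul_iff_left hM₀ hM.measure_lt_top.ne).1 ?_
  calc a * μ K * μ M = ∫⁻ _ in x • K, a * μ M ∂μ := by
        rw [setLIntegral_const, measure_smul]; ring
    _ ≤ ∫⁻ y in x • K, ((Λ ∩ y • M).encard : ℝ≥0∞) ∂μ :=
        lintegral_mono fun y => ENNReal.mul_le_of_le_div (ha y)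
    _ = ∑' l : Λ, μ ((l : G) • M⁻¹ ∩ x • K) := setLIntegral_encard_inter_smul hΛ hM _
    _ ≤ ∑' l : Λ, (x • (K * M)).indicator 1 (l : G) * μ M := ENNReal.tsum_le_tsum hterm
    _ = (Λ ∩ x • (K * M)).encard * μ M := by rw [ENNReal.tsum_mul_right, tsum_indicator_one]

theorem encard_le_mul_measure (hΛ : Λ.Countable) (hM : IsCompact M) (hM₀ : μ M ≠ 0)
    (ha : ∀ y : G, ((Λ ∩ y • M).encard : ℝ≥0∞) / μ M ≤ a) (x : G) :
    ((Λ ∩ x • K).encard : ℝ≥0∞) ≤ a * μ (K * M⁻¹) := by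
  have hterm (l : Λ) :
      (x • K).indicator 1 (l : G) * μ M ≤ μ ((l : G) • M⁻¹ ∩ x • (K * M⁻¹)) := by
    by_cases hl : (l : G) ∈ x • K
    · rw [Set.indicator_of_mem hl, Pi.one_apply, one_mul, ← smul_mul_assoc,
        Set.inter_eq_left.2 (Set.smul_set_subset_mul hl), measure_smul_inv]
    · simp [hl]
  have hMtop : μ M ≠ ∞ := hM.measure_lt_top.ne
  refine (ENNReal.mul_le_mul_iff_left hM₀ hMtop).1 ?_
  calc ((Λ ∩ x • K).encard : ℝ≥0∞) * μ M
      = ∑' l : Λ, (x • K).indicator 1 (l : G) * μ M := by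
        rw [ENNReal.tsum_mul_right, tsum_indicator_one]
    _ ≤ ∑' l : Λ, μ ((l : G) • M⁻¹ ∩ x • (K * M⁻¹)) := ENNReal.tsum_le_tsum hterm
    _ = ∫⁻ y in x • (K * M⁻¹), ((Λ ∩ y • M).encard : ℝ≥0∞) ∂μ :=
        (setLIntegral_encard_inter_smul hΛ hM _).symm
    _ ≤ ∫⁻ _ in x • (K * M⁻¹), a * μ M ∂μ :=
        lintegral_mono fun y => (ENNReal.div_le_iff hM₀ hMtop).1 (ha y)
    _ = a * μ (K * M⁻¹) * μ M := by rw [setLIntegral_const, measure_smul]; ring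

end Averages

theorem IsSeparated.encard_inter_smul_mul_le {U : Set G} {N : ℕ} (hs : IsSeparated Λ U N)
    (hU : IsUnitWindow U) {L : Set G} (hUL : U ⊆ L) (hML : M * U ⊆ L) (x : G) :
    ((Λ ∩ x • (K * M)).encard : ℝ≥0∞) ≤
      (Λ ∩ x • K).encard + N / μ U * μ (K * L ∩ (Kᶜ * L)) := by
  have hcover : Λ ∩ x • (K * M) ⊆ Λ ∩ x • K ∪ Λ ∩ x • ((K * M) \ K) := by
    rw [← Set.inter_union_distrib_left, ← Set.smul_set_union, Set.union_sdiff_self]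
    exact Set.inter_subset_inter_right _ (Set.smul_set_mono Set.subset_union_right)
  have hcard : ((Λ ∩ x • (K * M)).encard : ℝ≥0∞) ≤
      (Λ ∩ x • K).encard + (Λ ∩ x • ((K * M) \ K)).encard := by
    exact_mod_cast (Set.encard_le_encard hcover).trans (Set.encard_union_le _ _)
  refine hcard.trans (add_le_add_right ((hs.encard_inter_le hU μ _).trans ?_) _)
  rw [smul_mul_assoc, measure_smul]
  gcongr
  refine Set.subset_inter ?_ (Set.mul_subset_mul (fun _ h => h.2) hUL)
  calc (K * M) \ K * U ⊆ K * M * U := Set.mul_subset_mul_right Set.sdiff_subset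
    _ = K * (M * U) := mul_assoc _ _ _
    _ ⊆ K * L := Set.mul_subset_mul_left hML

namespace IsStrongFolner

variable [T2Space G] [μ.IsMulRightInvariant] {K : ℕ → Set G}

theorem exists_hasUpperBeurlingDensity (hK : IsStrongFolner μ K) (hΛ : Λ.Countable) :
    ∃ D, HasUpperBeurlingDensity μ K Λ D := by
  let D : ℕ → ℝ≥0∞ := fun n => ⨆ x : G, ((Λ ∩ x • K n).encard : ℝ≥0∞) / μ (K n)
  have hle (m : ℕ) : limsup D atTop ≤ D m := by
    have hL : IsCompact ((K m)⁻¹ ∪ {1}) := (hK.isCompact m).inv.union isCompact_singleton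
    have hlim := ENNReal.Tendsto.const_mul (a := D m) ((hK.tendsto _ hL).const_add 1)
      (Or.inl (by simp))
    rw [add_zero, mul_one] at hlim
    rw [← hlim.limsup_eq]
    refine limsup_le_limsup (Eventually.of_forall fun n => iSup_le fun x => ?_)
    have hn₀ := hK.nonnull n
    have hntop : μ (K n) ≠ ∞ := (hK.isCompact n).measure_lt_top.ne
    rw [ENNReal.div_le_iff hn₀ hntop, mul_assoc, add_mul, one_mul, ENNReal.div_mul_cancel hn₀ hntop]
    refine (encard_le_mul_measure hΛ (hK.isCompact m) (hK.nonnull m)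
      (fun y => le_iSup (fun x : G => ((Λ ∩ x • K m).encard : ℝ≥0∞) / μ (K m)) y) x).trans ?_
    gcongr
    exact (measure_mono (mul_subset_union_boundary (by simp)
      Set.subset_union_left)).trans (measure_union_le _ _)
  exact ⟨_, tendsto_of_le_liminf_of_limsup_le
    (le_liminf_of_le (by isBoundedDefault) (Eventually.of_forall hle)) le_rfl⟩

theorem exists_hasLowerBeurlingDensity (hK : IsStrongFolner μ K) {U : Set G} {N : ℕ}
    (hs : IsSeparated Λ U N) (hU : IsUnitWindow U) : ∃ D, HasLowerBeurlingDensity μ K Λ D := by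
  let D : ℕ → ℝ≥0∞ := fun n => ⨅ x : G, ((Λ ∩ x • K n).encard : ℝ≥0∞) / μ (K n)
  have hp : (N : ℝ≥0∞) / μ U ≠ ∞ :=
    ENNReal.div_ne_top (ENNReal.natCast_ne_top N) (hU.measure_ne_zero μ)
  have hle (m : ℕ) : D m ≤ liminf D atTop := by
    have hL : IsCompact (K m * closure U ∪ closure U) :=
      ((hK.isCompact m).mul hU.isCompact_closure).union hU.isCompact_closure
    have hlim := ENNReal.Tendsto.sub (tendsto_const_nhds (x := D m))
      (ENNReal.Tendsto.const_mul (hK.tendsto _ hL) (Or.inr hp)) (Or.inr (by simp))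
    rw [mul_zero, tsub_zero] at hlim
    rw [← hlim.liminf_eq]
    refine liminf_le_liminf (Eventually.of_forall fun n => le_iInf fun x => ?_)
    rw [tsub_le_iff_right, mul_div_assoc', ← ENNReal.add_div, ENNReal.le_div_iff_mul_le
      (Or.inl (hK.nonnull n)) (Or.inl (hK.isCompact n).measure_lt_top.ne)]
    refine (mul_measure_le_encard (hs.countable hU.mem_nhds) (hK.isCompact m) (hK.nonnull m)
      (fun y => iInf_le (fun x : G => ((Λ ∩ x • K m).encard : ℝ≥0∞) / μ (K m)) y) x).trans
      (hs.encard_inter_smul_mul_le hU ?_ ?_ x)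
    · exact subset_closure.trans Set.subset_union_right
    · exact (Set.mul_subset_mul_left subset_closure).trans Set.subset_union_left
  exact ⟨_, tendsto_of_le_liminf_of_limsup_le le_rfl
    (limsup_le_of_le (by isBoundedDefault) (Eventually.of_forall hle))⟩

end IsStrongFolner

end BeurlingDensity

namespace ProjectiveRep

variable {G H : Type*} [Group G] [MeasurableSpace G] [NormedAddCommGroup H]
  [InnerProductSpace ℂ H] {π : ProjectiveRep G H} {μ : Measure G} {d : ℝ} {Λ : Set G}

theorem IsFormalDegree.integral_kernelTerm (hd : π.IsFormalDegree μ d) (g : H) (h : Λ → H)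
    (l : Λ) :
    ∫ x, π.kernelTerm g h l x ∂μ = (d : ℂ)⁻¹ * inner ℂ (h l) (π.op l g) * (‖g‖ : ℂ) ^ 2 := by
  refine (hd.2 _ _ _ _).2.trans ?_
  rw [inner_conj_symm, inner_self_eq_norm_sq_to_K]
  rfl

theorem IsFormalDegree.enorm_inv_mul_mul_norm_sq (hd : π.IsFormalDegree μ d) (w : ℂ) (g : H) :
    ‖(d : ℂ)⁻¹ * w * (‖g‖ : ℂ) ^ 2‖ₑ = ENNReal.ofReal d⁻¹ * ‖g‖ₑ ^ 2 * ‖w‖ₑ := by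
  rw [enorm_mul, enorm_mul, enorm_pow, ← Complex.ofReal_inv, ← ofReal_norm ((d⁻¹ : ℝ) : ℂ),
    ← ofReal_norm (‖g‖ : ℂ), Complex.norm_real, Complex.norm_real, norm_norm,
    Real.norm_of_nonneg (inv_nonneg.2 hd.1.le), ofReal_norm, mul_right_comm]

theorem IsFormalDegree.ofReal_inv_mul_mul_ofReal (hd : π.IsFormalDegree μ d) (a : ℝ≥0∞) :
    ENNReal.ofReal d⁻¹ * a * ENNReal.ofReal d = a := by
  rw [mul_right_comm, ← ENNReal.ofReal_mul (inv_nonneg.2 hd.1.le), inv_mul_cancel₀ hd.1.ne',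
    ENNReal.ofReal_one, one_mul]

theorem tsum_kernelTerm (π : ProjectiveRep G H) (g : H) (h : Λ → H) (x : G) :
    ∑' l, π.kernelTerm g h l x =
      ∑' l : Λ, inner ℂ (π.op x g) (π.op l g) * inner ℂ (h l) (π.op x g) := by
  simp only [kernelTerm, coeff, inner_conj_symm]

end ProjectiveRep

section Comparison

variable {G H : Type*} [Group G] [TopologicalSpace G] [IsTopologicalGroup G]
  [SecondCountableTopology G] [MeasurableSpace G] [BorelSpace G]
  [NormedAddCommGroup H] [InnerProductSpace ℂ H]
  {π : ProjectiveRep G H} {μ : Measure G} {Λ U : Set G} {g : H} {h : Λ → H}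
  {N : ℕ} {B B' : ℝ≥0} {d : ℝ}

section CompactSet

variable [T2Space G] [IsFiniteMeasureOnCompacts μ] {K : Set G}

theorem enorm_setIntegral_kernel_sub_tsum_le (hs : IsSeparated Λ U N) (hU : U ∈ 𝓝 (1 : G))
    (hB : HasBesselBound (fun l : Λ => π.op l g) B) (hB' : HasBesselBound h B')
    (hd : π.IsFormalDegree μ d) (hK : IsCompact K) :
    ‖∫ x in K, ∑' l : Λ, inner ℂ (π.op x g) (π.op l g) * inner ℂ (h l) (π.op x g) ∂μ -
      ∑' l : Λ, K.indicator
        (fun _ => (d : ℂ)⁻¹ * inner ℂ (h l) (π.op l g) * (‖g‖ : ℂ) ^ 2) (l : G)‖ₑ ≤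
      ∑' l, truncationError π μ g h K l := by
  have := (hs.countable hU).to_subtype
  have hKtop : μ K ≠ ∞ := hK.measure_lt_top.ne
  have hfin : ∑' l, ∫⁻ x in K, ‖π.kernelTerm g h l x‖ₑ ∂μ ≠ ∞ :=
    ne_top_of_le_ne_top (by finiteness) (π.tsum_setLIntegral_enorm_kernelTerm_le g μ hB hB' K)
  have hsum : Summable fun l => ∫ x in K, π.kernelTerm g h l x ∂μ :=
    Summable.of_enorm (ne_top_of_le_ne_top hfin
      (ENNReal.tsum_le_tsum fun l => enorm_integral_le_lintegral_enorm _))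
  have hsum' : Summable fun l : Λ =>
      K.indicator (fun _ => ∫ x, π.kernelTerm g h l x ∂μ) (l : G) :=
    summable_of_hasFiniteSupport
      (((hs.finite_inter_isCompact hU hK).preimage Subtype.val_injective.injOn).subset
        fun l hl => ⟨l.2, Set.mem_of_indicator_ne_zero hl⟩)
  simp only [← π.tsum_kernelTerm, ← hd.integral_kernelTerm]
  rw [integral_tsum (fun l => (π.measurable_kernelTerm g h l).aestronglyMeasurable) hfin,
    ← hsum.tsum_sub hsum']
  exact enorm_tsum_le_tsum_enorm.trans (ENNReal.tsum_le_tsum fun l =>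
    enorm_setIntegral_sub_indicator_le_truncationError hK.measurableSet (hd.2 _ _ _ _).1)

theorem enorm_sq_mul_measure_le_mul_encard_add (hs : IsSeparated Λ U N) (hU : U ∈ 𝓝 (1 : G))
    (hB : HasBesselBound (fun l : Λ => π.op l g) B) (hB' : HasBesselBound h B')
    (hd : π.IsFormalDegree μ d) (hK : IsCompact K)
    (hdual : ∀ f, ∑' l : Λ, inner ℂ f (π.op l g) * inner ℂ (h l) f = (‖f‖ : ℂ) ^ 2)
    (hdiag : ∀ l : Λ, ‖inner ℂ (h l) (π.op l g)‖ ≤ 1) :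
    ‖g‖ₑ ^ 2 * μ K ≤ ENNReal.ofReal d⁻¹ * ‖g‖ₑ ^ 2 * (Λ ∩ K).encard +
      ∑' l, truncationError π μ g h K l := by
  have herr := enorm_setIntegral_kernel_sub_tsum_le hs hU hB hB' hd hK
  simp only [hdual, LinearIsometryEquiv.norm_map] at herr
  set S := ∑' l : Λ, K.indicator
    (fun _ => (d : ℂ)⁻¹ * inner ℂ (h l) (π.op l g) * (‖g‖ : ℂ) ^ 2) (l : G)
  have hS : ‖S‖ₑ ≤ ENNReal.ofReal d⁻¹ * ‖g‖ₑ ^ 2 * (Λ ∩ K).encard := by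
    rw [← tsum_indicator_one, ← ENNReal.tsum_mul_left]
    refine enorm_tsum_le_tsum_enorm.trans (ENNReal.tsum_le_tsum fun l => ?_)
    by_cases hl : (l : G) ∈ K
    · rw [Set.indicator_of_mem hl, Set.indicator_of_mem hl, hd.enorm_inv_mul_mul_norm_sq]
      gcongr
      rw [← ofReal_norm]
      exact ENNReal.ofReal_le_one.2 (hdiag l)
    · simp [hl]
  have hI : ‖∫ _ in K, (‖g‖ : ℂ) ^ 2 ∂μ‖ₑ = ‖g‖ₑ ^ 2 * μ K := by
    rw [setIntegral_const, enorm_smul, enorm_pow, ← ofReal_norm (‖g‖ : ℂ), Complex.norm_real,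
      norm_norm, ofReal_norm, mul_comm, Measure.real, Real.enorm_of_nonneg ENNReal.toReal_nonneg,
      ENNReal.ofReal_toReal hK.measure_lt_top.ne]
  calc ‖g‖ₑ ^ 2 * μ K = ‖S + (∫ _ in K, (‖g‖ : ℂ) ^ 2 ∂μ - S)‖ₑ := by rw [add_sub_cancel, hI]
    _ ≤ ‖S‖ₑ + ‖∫ _ in K, (‖g‖ : ℂ) ^ 2 ∂μ - S‖ₑ := enorm_add_le _ _
    _ ≤ _ := add_le_add hS herr

theorem mul_encard_le_enorm_sq_mul_measure_add (hs : IsSeparated Λ U N) (hU : U ∈ 𝓝 (1 : G))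
    (hB : HasBesselBound (fun l : Λ => π.op l g) B) (hB' : HasBesselBound h B')
    (hd : π.IsFormalDegree μ d) (hK : IsCompact K)
    (hdual : ∀ f, ‖∑' l : Λ, inner ℂ f (π.op l g) * inner ℂ (h l) f‖ ≤ ‖f‖ ^ 2)
    (hdiag : ∀ l : Λ, inner ℂ (h l) (π.op l g) = 1) :
    ENNReal.ofReal d⁻¹ * ‖g‖ₑ ^ 2 * (Λ ∩ K).encard ≤
      ‖g‖ₑ ^ 2 * μ K + ∑' l, truncationError π μ g h K l := by
  have herr := enorm_setIntegral_kernel_sub_tsum_le hs hU hB hB' hd hK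
  simp only [hdiag] at herr
  set I := ∫ x in K, ∑' l : Λ, inner ℂ (π.op x g) (π.op l g) * inner ℂ (h l) (π.op x g) ∂μ
  set S := ∑' l : Λ, K.indicator (fun _ => (d : ℂ)⁻¹ * 1 * (‖g‖ : ℂ) ^ 2) (l : G) with hSdef
  have hS : ‖S‖ₑ = ENNReal.ofReal d⁻¹ * ‖g‖ₑ ^ 2 * (Λ ∩ K).encard := by
    rw [hSdef, tsum_subtype Λ (K.indicator _), Set.indicator_indicator, ← tsum_subtype, tsum_const,
      Nat.card_coe_set_eq, ← (hs.finite_inter_isCompact hU hK).cast_ncard_eq, nsmul_eq_mul,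
      enorm_mul, hd.enorm_inv_mul_mul_norm_sq, enorm_one, mul_one, mul_comm]
    simp [← ofReal_norm]
  have hI : ‖I‖ₑ ≤ ‖g‖ₑ ^ 2 * μ K := by
    refine (enorm_integral_le_lintegral_enorm _).trans ?_
    rw [← setLIntegral_const]
    refine lintegral_mono fun x => ?_
    rw [← ofReal_norm, ← ofReal_norm g, ← ENNReal.ofReal_pow (norm_nonneg _)]
    refine ENNReal.ofReal_le_ofReal ((hdual _).trans_eq ?_)
    rw [LinearIsometryEquiv.norm_map]
  calc ENNReal.ofReal d⁻¹ * ‖g‖ₑ ^ 2 * (Λ ∩ K).encard = ‖I - (I - S)‖ₑ := by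
        rw [sub_sub_cancel, hS]
    _ ≤ ‖I‖ₑ + ‖I - S‖ₑ := enorm_sub_le
    _ ≤ _ := add_le_add hI herr

end CompactSet

variable [LocallyCompactSpace G] [TopologicalSpace.SeparableSpace H] [μ.IsHaarMeasure]

theorem HasBesselBound.exists_isUnitWindow_isSeparated
    (hB : HasBesselBound (fun l : Λ => π.op l g) B) (hg : g ∈ π.localized μ) (hg₀ : g ≠ 0) :
    ∃ U N, IsUnitWindow U ∧ IsSeparated Λ U N ∧
      ∫⁻ x, localMaximal U (π.coeff g g) x ^ 2 ∂μ ≠ ∞ := by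
  obtain ⟨V, hV, N, hs⟩ := hB.exists_isSeparated μ hg₀
  obtain ⟨U, hUV, hU, hM⟩ := exists_isUnitWindow_of_mem_localized hg hV
  exact ⟨U, N, hU, hs.mono hUV, hM⟩

variable [T2Space G]

theorem IsStrongFolner.eventually_tsum_truncationError_le {K : ℕ → Set G}
    (hK : IsStrongFolner μ K) (hs : IsSeparated Λ U N) (hU : IsUnitWindow U)
    (hM : ∫⁻ x, localMaximal U (π.coeff g g) x ^ 2 ∂μ ≠ ∞)
    (hB : HasBesselBound (fun l : Λ => π.op l g) B) (hB' : HasBesselBound h B')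
    (hd : π.IsFormalDegree μ d) {ε : ℝ≥0∞} (hε : ε ≠ 0) :
    ∀ᶠ n in atTop, ∀ x : G, ∑' l, truncationError π μ g h (x • K n) l ≤ ε * μ (K n) := by
  have hε₂ : ε / 2 ≠ 0 := (ENNReal.half_pos hε).ne'
  obtain ⟨L, hL, C, hC, hE⟩ := exists_tsum_truncationError_le hs hU hM hB hB' hd hε₂
  have hlim := ENNReal.Tendsto.const_mul (hK.tendsto L hL) (Or.inr hC)
  rw [mul_zero] at hlim
  filter_upwards [hlim.eventually_lt_const (pos_iff_ne_zero.2 hε₂)] with n hn x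
  have hbdry : C * μ (K n * L ∩ ((K n)ᶜ * L)) ≤ ε / 2 * μ (K n) := by
    rw [mul_div_assoc'] at hn
    exact (ENNReal.div_le_iff (hK.nonnull n) (hK.isCompact n).measure_lt_top.ne).1 hn.le
  have htrans : x • K n * L ∩ ((x • K n)ᶜ * L) = x • (K n * L ∩ ((K n)ᶜ * L)) := by
    rw [← Set.smul_set_compl, smul_mul_assoc, smul_mul_assoc, ← Set.smul_set_inter]
  calc ∑' l, truncationError π μ g h (x • K n) l
      ≤ ε / 2 * μ (K n) + C * μ (K n * L ∩ ((K n)ᶜ * L)) := by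
        simpa only [htrans, measure_smul] using hE (x • K n)
    _ ≤ ε / 2 * μ (K n) + ε / 2 * μ (K n) := add_le_add_right hbdry _
    _ = ε * μ (K n) := by rw [← add_mul, ENNReal.add_halves]

variable [CompleteSpace H] [μ.IsMulRightInvariant] {K : ℕ → Set G}

theorem IsFrame.exists_hasLowerBeurlingDensity_ge (he : IsFrame fun l : Λ => π.op l g)
    (hg₀ : g ≠ 0) (hg : g ∈ π.localized μ) (hd : π.IsFormalDegree μ d) (hK : IsStrongFolner μ K) :
    ∃ D : ℝ≥0∞, HasLowerBeurlingDensity μ K Λ D ∧ ENNReal.ofReal d ≤ D := by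
  obtain ⟨h, B, B', hB, hB', hdual, hdiag⟩ := he.exists_dual
  obtain ⟨U, N, hU, hs, hM⟩ := hB.exists_isUnitWindow_isSeparated hg hg₀
  obtain ⟨D, hD⟩ := hK.exists_hasLowerBeurlingDensity hs hU
  refine ⟨D, hD, ENNReal.le_of_forall_pos_le_add fun η hη _ => ge_of_tendsto (hD.add_const _) ?_⟩
  let q := ENNReal.ofReal d⁻¹ * ‖g‖ₑ ^ 2
  have hq : q ≠ 0 := by simp [q, hd.1, hg₀]
  have hqtop : q ≠ ∞ := by finiteness
  filter_upwards [hK.eventually_tsum_truncationError_le hs hU hM hB hB' hd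
    (mul_ne_zero hq (ENNReal.coe_ne_zero.2 hη.ne'))] with n hn
  have hn₀ := hK.nonnull n
  have hntop : μ (K n) ≠ ∞ := (hK.isCompact n).measure_lt_top.ne
  rw [← tsub_le_iff_right]
  refine le_iInf fun x => ?_
  rw [tsub_le_iff_right, ← ENNReal.mul_div_cancel_right hn₀ hntop (a := (η : ℝ≥0∞)),
    ← ENNReal.add_div, ENNReal.le_div_iff_mul_le (Or.inl hn₀) (Or.inl hntop),
    ← ENNReal.mul_le_mul_iff_right hq hqtop]
  calc q * (ENNReal.ofReal d * μ (K n)) = ‖g‖ₑ ^ 2 * μ (x • K n) := by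
        rw [← mul_assoc, hd.ofReal_inv_mul_mul_ofReal, measure_smul]
    _ ≤ q * (Λ ∩ x • K n).encard + ∑' l, truncationError π μ g h (x • K n) l :=
        enorm_sq_mul_measure_le_mul_encard_add hs hU.mem_nhds hB hB' hd
          ((hK.isCompact n).smul x) hdual hdiag
    _ ≤ q * (Λ ∩ x • K n).encard + q * η * μ (K n) := add_le_add_right (hn x) _
    _ = q * ((Λ ∩ x • K n).encard + η * μ (K n)) := by ring

theorem IsRieszSequence.exists_hasUpperBeurlingDensity_le
    (he : IsRieszSequence fun l : Λ => π.op l g) (hg₀ : g ≠ 0) (hg : g ∈ π.localized μ)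
    (hd : π.IsFormalDegree μ d) (hK : IsStrongFolner μ K) :
    ∃ D : ℝ≥0∞, HasUpperBeurlingDensity μ K Λ D ∧ D ≤ ENNReal.ofReal d := by
  obtain ⟨h, B, B', hB, hB', hdual, hdiag⟩ := he.exists_dual
  obtain ⟨U, N, hU, hs, hM⟩ := hB.exists_isUnitWindow_isSeparated hg hg₀
  obtain ⟨D, hD⟩ := hK.exists_hasUpperBeurlingDensity (hs.countable hU.mem_nhds)
  refine ⟨D, hD, ENNReal.le_of_forall_pos_le_add fun η hη _ => le_of_tendsto hD ?_⟩
  let q := ENNReal.ofReal d⁻¹ * ‖g‖ₑ ^ 2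
  have hq : q ≠ 0 := by simp [q, hd.1, hg₀]
  have hqtop : q ≠ ∞ := by finiteness
  filter_upwards [hK.eventually_tsum_truncationError_le hs hU hM hB hB' hd
    (mul_ne_zero hq (ENNReal.coe_ne_zero.2 hη.ne'))] with n hn
  refine iSup_le fun x => ENNReal.div_le_of_le_mul ?_
  rw [← ENNReal.mul_le_mul_iff_right hq hqtop]
  calc q * (Λ ∩ x • K n).encard
      ≤ ‖g‖ₑ ^ 2 * μ (x • K n) + ∑' l, truncationError π μ g h (x • K n) l :=
        mul_encard_le_enorm_sq_mul_measure_add hs hU.mem_nhds hB hB' hd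
          ((hK.isCompact n).smul x) hdual hdiag
    _ ≤ q * ENNReal.ofReal d * μ (K n) + q * η * μ (K n) := by
        rw [hd.ofReal_inv_mul_mul_ofReal, measure_smul]
        exact add_le_add_right (hn x) _
    _ = q * ((ENNReal.ofReal d + η) * μ (K n)) := by ring

end Comparison

section Degenerate

variable {H ι : Type*} [NormedAddCommGroup H] [InnerProductSpace ℂ H] {e : ι → H}

theorem IsFrame.exists_ne_zero [Nontrivial H] (he : IsFrame e) : ∃ i, e i ≠ 0 := by
  by_contra! h₀
  obtain ⟨A, B, hA, -, h⟩ := he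
  obtain ⟨v, hv⟩ := exists_ne (0 : H)
  have hle : A * ‖v‖ ^ 2 ≤ 0 := by simpa [h₀] using (h v).2.1
  have : 0 < ‖v‖ := norm_pos_iff.2 hv
  exact hle.not_gt (by positivity)

theorem IsRieszSequence.ne_zero (he : IsRieszSequence e) (i : ι) : e i ≠ 0 := by
  classical
  intro hi
  obtain ⟨A, B, hA, -, h⟩ := he
  have hterm (j : ι) : (lp.single 2 i (1 : ℂ) : lp (fun _ : ι => ℂ) 2) j • e j = 0 := by
    rcases eq_or_ne j i with rfl | hj
    · rw [hi, smul_zero]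
    · rw [lp.single_apply_ne _ _ _ hj, zero_smul]
  have hle : A ≤ 0 := by
    simpa only [hterm, tsum_zero, norm_zero, zero_pow two_ne_zero,
      lp.norm_single (two_pos : (0 : ℝ≥0∞) < 2), norm_one, one_pow, mul_one]
      using (h (lp.single 2 i 1)).2.1
  exact hle.not_gt hA

theorem hasUpperBeurlingDensity_empty {G : Type*} [Group G] [MeasurableSpace G] (μ : Measure G)
    (K : ℕ → Set G) : HasUpperBeurlingDensity μ K ∅ 0 := by
  simp [HasUpperBeurlingDensity]

end Degenerate

end Coherent

theorem theorem3p5 {G H : Type*}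
    [Group G] [TopologicalSpace G] [IsTopologicalGroup G] [T2Space G] [LocallyCompactSpace G]
    [SecondCountableTopology G] [MeasurableSpace G] [BorelSpace G]
    (μ : MeasureTheory.Measure G) [μ.IsHaarMeasure] [μ.IsMulRightInvariant]
    [NormedAddCommGroup H] [InnerProductSpace ℂ H] [CompleteSpace H]
    [TopologicalSpace.SeparableSpace H]
    (π : Coherent.ProjectiveRep G H) (hπ : π.IsDiscreteSeries μ) :
    (∃! d : ℝ, π.IsFormalDegree μ d) ∧
    ∀ d : ℝ, π.IsFormalDegree μ d →
    ∀ K : ℕ → Set G, Coherent.IsStrongFolner μ K →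
    ∀ (Λ : Set G) (g : H), g ∈ π.localized μ →
      (Coherent.IsFrame (fun l : Λ => π.op l g) →
        ∃ D : ℝ≥0∞, Coherent.HasLowerBeurlingDensity μ K Λ D ∧ ENNReal.ofReal d ≤ D) ∧
      (Coherent.IsRieszSequence (fun l : Λ => π.op l g) →
        ∃ D : ℝ≥0∞, Coherent.HasUpperBeurlingDensity μ K Λ D ∧ D ≤ ENNReal.ofReal d) := by
  refine ⟨hπ.existsUnique_isFormalDegree, fun d hd K hK Λ g hg => ⟨fun he => ?_, fun he => ?_⟩⟩
  · obtain ⟨v, hv, -⟩ := hπ.2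
    have : Nontrivial H := ⟨v, 0, hv⟩
    obtain ⟨l, hl⟩ := he.exists_ne_zero
    exact he.exists_hasLowerBeurlingDensity_ge ((π.op l).map_eq_zero_iff.not.1 hl) hg hd hK
  · rcases Λ.eq_empty_or_nonempty with rfl | ⟨l, hl⟩
    · exact ⟨0, Coherent.hasUpperBeurlingDensity_empty μ K, zero_le⟩
    · have hg₀ : g ≠ 0 := (π.op l).map_eq_zero_iff.not.1 (he.ne_zero ⟨l, hl⟩)
      exact he.exists_hasUpperBeurlingDensity_le hg₀ hg hd hK
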